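/- \textbf{Setting.} A halfspace $h$ over $\mathbb{R}^2$ is given by a unit vector $v\in S^1$ and a bias $b\in\mathbb{R}$; the label of $x$ is $1$ if $\langle v,x\rangle+b\ge 0$ and $0$ otherwise. A label query on $x$ returns the label of $x$, and a comparison query on $(x,y)$ returns whether $\langle x,v\rangle\ge\langle y,v\rangle$. A \emph{learner} has a query tape (storing points of $\mathbb{R}^2$), a work tape (storing bits), a sample counter and a query counter; all are empty or zero at the start. In each step it (i) draws a fresh unlabeled point and puts it on the query tape, or (ii) removes a point from the query tape, or (iii) makes a label or comparison query on points stored on the query tape, appending the one-bit response to the work tape, or (iv) runs an algebraic decision tree on the stored points (its tests are signs of arithmetic expressions in the coordinates, built from $1,+,-,\times$) and overwrites the work tape with the resulting bits, or (v) halts and outputs a classifier, namely an algebraic decision tree that, applied to the stored points and a new point $x$, returns a label or $\bot$ ("I don't know"). The choice of the step is an arbitrary (non-uniform) function of the number of stored points, the contents of the work tape and the two counters. A step costs one unit of time, plus the number of bits on the work tape, plus the size of the decision tree that it runs or outputs (including all arithmetic operations in it and all bits written at its leaves). The memory in use is the number of stored points plus the number of bits on the work tape plus the size of the decision tree currently run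 or output; the counters are not charged. \textbf{Statement.} There are absolute constants $C$ and $M$ such that for all $\varepsilon,\delta\in(0,1)$, with $L=\max\{1,\log(1/(\varepsilon\delta))\}$, there is a learner $A$ with the following properties. Write $A_{h,S}$ for the classifier that $A$ outputs when the unknown halfspace is $h$ and the stream of sampled points is $S=(s_0,s_1,\dots)$. \begin{enumerate} \item (Reliable) For every halfspace $h$, every stream $S$ and every $x\in\mathbb{R}^2$: if $A_{h,S}(x)\ne\bot$, then $A_{h,S}(x)$ is the label of $x$ under $h$. \item (Probably useful) For every Borel probability measure $D$ on $\mathbb{R}^2$ and every halfspace $h$, \[ \Pr_{S\sim D^{\mathbb{N}}}\Big[\Pr_{x\sim D}\big[A_{h,S}(x)=\bot\big]>\varepsilon\Big]<\delta . \] \item (Complexity) For every halfspace $h$ and every stream $S$, the learner halts after at most $C\,L$ queries and time at most $C\,L^2/\varepsilon$, and its memory never exceeds $M$. \end{enumerate} That is, halfspaces over $\mathbb{R}^2$ with labels and comparisons are actively RPU-learnable with $O(\log(1/(\varepsilon\delta)))$ queries, $O(1)$ memory and running time $O(\log^2(1/(\delta\varepsilon))/\varepsilon)$. -/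

import Mathlib

open MeasureTheory

namespace HalfspaceLearning

/-- The instance space: the Euclidean plane. -/
abbrev Plane : Type := EuclideanSpace ℝ (Fin 2)

/-! ### Halfspaces, labels and comparisons -/

/-- A (non-homogeneous) halfspace in the plane, given by a unit normal vector and a bias. -/
structure Halfspace where
  normal : Plane
  bias : ℝ
  norm_normal : ‖normal‖ = 1

/-- The label oracle: the sign of `⟨v, x⟩ + b`, where `true` stands for `⟨v, x⟩ + b ≥ 0`. -/
noncomputable def Halfspace.label (h : Halfspace) (x : Plane) : Bool :=
  decide (0 ≤ inner ℝ h.normal x + h.bias)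

/-- The comparison oracle: is `⟨x, v⟩ ≥ ⟨y, v⟩`? -/
noncomputable def Halfspace.compare (h : Halfspace) (x y : Plane) : Bool :=
  decide (inner ℝ h.normal y ≤ inner ℝ h.normal x)

/-! ### Arithmetic on points (real arithmetic, every operation is charged) -/

/-- Arithmetic expressions in the coordinates of points indexed by `ι`. -/
inductive Expr (ι : Type) : Type
  | one : Expr ι
  | coord (i : ι) (c : Fin 2) : Expr ι
  | add (e f : Expr ι) : Expr ι
  | sub (e f : Expr ι) : Expr ι
  | mul (e f : Expr ι) : Expr ι

noncomputable def Expr.eval {ι : Type} (p : ι → Plane) : Expr ι → ℝ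
  | .one => 1
  | .coord i c => p i c
  | .add e f => e.eval p + f.eval p
  | .sub e f => e.eval p - f.eval p
  | .mul e f => e.eval p * f.eval p

/-- The number of nodes of an expression. -/
def Expr.size {ι : Type} : Expr ι → ℕ
  | .one => 1
  | .coord _ _ => 1
  | .add e f => e.size + f.size + 1
  | .sub e f => e.size + f.size + 1
  | .mul e f => e.size + f.size + 1

/-- Algebraic decision trees: branch on `0 ≤ e` for arithmetic expressions `e` in the coordinates
of points indexed by `ι`; the leaves hold results in `α`. -/
inductive DecisionTree (ι α : Type) : Type
  | leaf (a : α) : DecisionTree ι α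
  | branch (e : Expr ι) (yes no : DecisionTree ι α) : DecisionTree ι α

noncomputable def DecisionTree.eval {ι α : Type} (p : ι → Plane) : DecisionTree ι α → α
  | .leaf a => a
  | .branch e yes no => if 0 ≤ e.eval p then yes.eval p else no.eval p

/-- The size of a decision tree: all nodes, all nodes of the expressions that are tested, and
the length `len a` of every result `a`. -/
def DecisionTree.size {ι α : Type} (len : α → ℕ) : DecisionTree ι α → ℕ
  | .leaf a => 1 + len a
  | .branch e yes no => 1 + e.size + yes.size len + no.size len

/-! ### Learners with a query tape, a work tape, a sample counter and a query counter -/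

/-- What a learner that stores `n` points on its query tape can do in one step.

* `sample`: draw a fresh unlabeled point and put it on the query tape;
* `discard i`: remove the `i`-th point from the query tape;
* `askLabel i`, `askCompare i j`: query points that are stored on the query tape; the
  response (one bit) is written at the end of the work tape;
* `compute t`: run the algebraic decision tree `t` on the stored points and replace the
  contents of the work tape by the bits found at the leaf that is reached;
* `output t`: halt, and return the classifier that answers on a point `x` by running `t`
  on the stored points and `x` (which is the point with index `none`); the answer is a label,
  or `none` for "I don't know". -/
inductive Action (n : ℕ) : Type
  | sample : Action n
  | discard (i : Fin n) : Action n
  | askLabel (i : Fin n) : Action n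
  | askCompare (i j : Fin n) : Action n
  | compute (t : DecisionTree (Fin n) (List Bool)) : Action n
  | output (t : DecisionTree (Option (Fin n)) (Option Bool)) : Action n

/-- The amount of computation in an action: the size of the decision tree that is run or
returned, including the bits that are written. -/
def Action.size {n : ℕ} : Action n → ℕ
  | .compute t => t.size List.length
  | .output t => t.size (fun _ => 0)
  | _ => 0

/-- The classifier that is returned by an action, if the action halts. -/
noncomputable def Action.classify {n : ℕ} (p : Fin n → Plane) (x : Plane) :
    Action n → Option Bool
  | .output t => t.eval (fun i => i.elim x p)
  | _ => none

def Action.Halts {n : ℕ} : Action n → Prop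
  | .output _ => True
  | _ => False

/-- The contents of the two tapes and of the two counters. -/
structure Config where
  points : List Plane
  work : List Bool
  samples : ℕ
  queries : ℕ

/-- A learner is a (non-uniform) transition function: the next action depends on the number of
stored points, the contents of the work tape, the sample counter and the query counter.
The points themselves are accessible only through queries and through arithmetic. -/
def Learner : Type :=
  (numPoints : ℕ) → (work : List Bool) → (samples queries : ℕ) → Action numPoints

namespace Learner

/-- The action that the learner takes in a configuration. -/
def action (A : Learner) (c : Config) : Action c.points.length :=
  A c.points.length c.work c.samples c.queries

/-- One step of the learner, where `h` is the unknown halfspace and `ω 0, ω 1, …` are the points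
that the sample oracle returns. A configuration in which the learner halts is left unchanged. -/
noncomputable def step (A : Learner) (h : Halfspace) (ω : ℕ → Plane) (c : Config) : Config :=
  match A.action c with
  | .sample => { c with points := c.points ++ [ω c.samples], samples := c.samples + 1 }
  | .discard i => { c with points := c.points.eraseIdx i }
  | .askLabel i =>
      { c with work := c.work ++ [h.label (c.points.get i)], queries := c.queries + 1 }
  | .askCompare i j =>
      { c with
        work := c.work ++ [h.compare (c.points.get i) (c.points.get j)]
        queries := c.queries + 1 }
  | .compute t => { c with work := t.eval c.points.get }
  | .output _ => c

/-- The configuration after a number of steps; the tapes are empty at the start. -/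
noncomputable def config (A : Learner) (h : Halfspace) (ω : ℕ → Plane) : ℕ → Config
  | 0 => ⟨[], [], 0, 0⟩
  | n + 1 => A.step h ω (A.config h ω n)

/-- The learner halts in step `n`. -/
def HaltsAt (A : Learner) (h : Halfspace) (ω : ℕ → Plane) (n : ℕ) : Prop :=
  (A.action (A.config h ω n)).Halts

/-- The answer of the classifier that the learner returns (`none` is "I don't know", and also
the default answer if the learner never halts). -/
noncomputable def answer (A : Learner) (h : Halfspace) (ω : ℕ → Plane) (x : Plane) :
    Option Bool :=
  open Classical in
  if H : ∃ n, A.HaltsAt h ω n then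
    (A.action (A.config h ω (Nat.find H))).classify (A.config h ω (Nat.find H)).points.get x
  else none

/-- The memory in use in a configuration: the number of points on the query tape, the number of
bits on the work tape, and the size of the computation that is carried out on them. -/
def space (A : Learner) (c : Config) : ℕ :=
  c.points.length + c.work.length + (A.action c).size

/-- The time of the step taken in a configuration: one unit, reading the work tape, and
the computation that is carried out. -/
def stepTime (A : Learner) (c : Config) : ℕ :=
  1 + c.work.length + (A.action c).size

/-- On every halfspace and every stream of sample points, the learner halts after at most `q`
queries and time at most `T`, and its memory never exceeds `M`. -/
def RunsWithin (A : Learner) (q T : ℝ) (M : ℕ) : Prop :=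
  ∀ (h : Halfspace) (ω : ℕ → Plane), ∃ N : ℕ,
    A.HaltsAt h ω N ∧
    ((A.config h ω N).queries : ℝ) ≤ q ∧
    ((∑ n ∈ Finset.range (N + 1), A.stepTime (A.config h ω n) : ℕ) : ℝ) ≤ T ∧
    ∀ n ≤ N, A.space (A.config h ω n) ≤ M

/-- Reliable: the returned classifier never gives a wrong label. -/
def Reliable (A : Learner) : Prop :=
  ∀ (h : Halfspace) (ω : ℕ → Plane) (x : Plane),
    A.answer h ω x ≠ none → A.answer h ω x = some (h.label x)

/-- Probably useful: for every distribution `D` and every halfspace, the probability over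
independent samples from `D` that the returned classifier abstains on more than an
`ε`-fraction of the space is less than `δ`. -/
def ProbablyUseful (A : Learner) (ε δ : ℝ) : Prop :=
  ∀ (D : Measure Plane) [IsProbabilityMeasure D] (h : Halfspace),
    Measure.infinitePi (fun _ : ℕ => D)
      {ω | ENNReal.ofReal ε < D {x | A.answer h ω x = none}} < ENNReal.ofReal δ

end Learner

end HalfspaceLearning

/-! Inference. A comparison of stored points `a`, `b` says that the unknown normal has nonnegative
inner product with `a - b` or with `b - a`. These directions generate a cone on which the normal is
nonnegative, so a point that differs from a labelled stored point by a vector of this cone, in the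
right direction, inherits its label. The classifier answers exactly in these cases (`Known`) and is
therefore never wrong.

Two facts about the plane make the method cheap. Finitely many vectors in a halfplane lie in the
cone of at most four of them (`exists_extremal`). Hence all inferences from a finite set survive on
ten points: the endpoints of four differences and the closest point of each label
(`exists_removable`, `unknown_compress`). Likewise, in any finite sample at most ten points, five
per label, cannot be inferred from the others (`card_unknown_le`). By exchangeability the expected
mass that cannot be inferred from `m` independent points is at most `10 / (m + 1)`
(`expectedUnknown_nil_le`).

The learner works in phases. With at most ten points stored, let `U` be the set of points that
cannot yet be inferred. A phase draws `B ≥ 32 / ε` points and keeps the first 19 that fall in `U`;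
this test needs only arithmetic and recorded answers, no queries. The kept points are independent
samples of `D` conditioned on `U`, so 19 of them halve the mass of `U` in expectation. If `D U > ε`,
the probability of finding fewer than 19 is at most `1 / 4`. So the expected mass, counted as zero
once it is at most `ε`, shrinks by a factor `3 / 4` per phase (`phaseBound_nil_le`). After `O(L)`
phases Markov's inequality gives the claim (`measure_phases_lt`).

At the end of a phase at most 29 points are queried completely and compressed back to ten, which
takes `O(1)` queries and steps. Cone membership is a Boolean combination of polynomial signs, so
inference and compression are run by decision trees. Only finitely many such trees are needed, so
their sizes are bounded by an absolute constant (`maxTree`). The simulation lemmas, ending in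
`exists_halt`, show that the learner carries out the process `phases`. -/

namespace HalfspaceLearning

/-! ### Planar cones -/

/-- The oriented area spanned by two vectors. -/
noncomputable def area (u w : Plane) : ℝ := u 0 * w 1 - u 1 * w 0

/-- The inner product in coordinates. -/
noncomputable def dot (u w : Plane) : ℝ := u 0 * w 0 + u 1 * w 1

theorem inner_eq_dot (u w : Plane) : inner ℝ u w = dot u w := by
  simp [PiLp.inner_apply, Fin.sum_univ_two, dot, mul_comm]

theorem plane_ext {u w : Plane} (h0 : u 0 = w 0) (h1 : u 1 = w 1) : u = w := by
  ext i; fin_cases i <;> assumption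

theorem dot_self_eq_zero {u : Plane} (h : dot u u ≤ 0) : u = 0 := by
  unfold dot at h
  apply plane_ext <;> simp <;> nlinarith [mul_self_nonneg (u 0), mul_self_nonneg (u 1)]

/-- Membership of `y` in the ray spanned by `u`, as a sign condition. -/
def InRay (u y : Plane) : Prop := area u y = 0 ∧ (¬ dot u y ≤ 0 ∨ dot y y ≤ 0)

/-- Membership of `y` in the cone spanned by `u` and `w`, as a sign condition. -/
def InCone (u w y : Plane) : Prop :=
  (area u w ≠ 0 ∧ 0 ≤ area y w * area u w ∧ 0 ≤ area u y * area u w) ∨ InRay u y ∨ InRay w y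

/-- The strict sign of `dot u y` excludes the opposite ray; the alternative `dot y y ≤ 0` admits `y
= 0`, also when `u = 0`. -/
theorem inRay_iff {u y : Plane} : InRay u y ↔ ∃ s : ℝ, 0 ≤ s ∧ y = s • u := by
  constructor
  · rintro ⟨h, h' | h'⟩
    · have hu : 0 < dot u u := by
        by_contra hu
        have := dot_self_eq_zero (not_lt.1 hu)
        subst this
        simp [dot] at h'
      have hu' := hu.ne'
      refine ⟨dot u y / dot u u, div_nonneg (not_le.1 h').le hu.le, ?_⟩
      unfold area at h
      apply plane_ext <;> simp <;> field_simp <;> unfold dot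
      · linear_combination (- u 1) * h
      · linear_combination (u 0) * h
    · exact ⟨0, le_rfl, by simp [dot_self_eq_zero h']⟩
  · rintro ⟨s, hs, rfl⟩
    refine ⟨by simp [area]; ring, ?_⟩
    by_cases h : dot (s • u) (s • u) ≤ 0
    · exact Or.inr h
    · left
      intro h'
      apply h
      have : dot (s • u) (s • u) = s * dot u (s • u) := by simp [dot]; ring
      rw [this]
      exact mul_nonpos_of_nonneg_of_nonpos hs h'

/-- For independent `u`, `w` the coefficients are given by Cramer's rule, and multiplying by `area u
w` instead of dividing keeps the tests polynomial. For parallel vectors the cone is the union of the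
two rays, even when they point in opposite directions. -/
theorem inCone_iff {u w y : Plane} :
    InCone u w y ↔ ∃ s t : ℝ, 0 ≤ s ∧ 0 ≤ t ∧ y = s • u + t • w := by
  constructor
  · rintro (⟨h, h1, h2⟩ | h | h)
    · refine ⟨area y w / area u w, area u y / area u w, ?_, ?_, ?_⟩
      · rw [← mul_div_mul_right _ _ h]; exact div_nonneg h1 (mul_self_nonneg _)
      · rw [← mul_div_mul_right _ _ h]; exact div_nonneg h2 (mul_self_nonneg _)
      · apply plane_ext <;> simp <;> field_simp <;> unfold area <;> ring
    · obtain ⟨s, hs, rfl⟩ := inRay_iff.1 h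
      exact ⟨s, 0, hs, le_rfl, by simp⟩
    · obtain ⟨s, hs, rfl⟩ := inRay_iff.1 h
      exact ⟨0, s, le_rfl, hs, by simp⟩
  · rintro ⟨s, t, hs, ht, rfl⟩
    by_cases h : area u w = 0
    · by_cases hu : dot u u ≤ 0
      · obtain rfl := dot_self_eq_zero hu
        exact Or.inr (Or.inr (inRay_iff.2 ⟨t, ht, by simp⟩))
      · -- `w` is a multiple of `u`
        have hu' : dot u u ≠ 0 := fun h => hu h.le
        have hw : w = (dot u w / dot u u) • u := by
          unfold area at h
          apply plane_ext <;> simp <;> field_simp <;> unfold dot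
          · linear_combination (- u 1) * h
          · linear_combination (u 0) * h
        set r := dot u w / dot u u
        rcases le_total 0 (s + t * r) with h0 | h0
        · refine Or.inr (Or.inl (inRay_iff.2 ⟨s + t * r, h0, ?_⟩))
          rw [hw, smul_smul, add_smul]
        · by_cases hr : r < 0
          · refine Or.inr (Or.inr (inRay_iff.2 ⟨(s + t * r) / r, div_nonneg_of_nonpos h0 hr.le, ?_⟩))
            rw [hw, smul_smul, smul_smul, ← add_smul,
              div_mul_cancel₀ _ hr.ne]
          · have : 0 ≤ t * r := mul_nonneg ht (not_lt.1 hr)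
            refine Or.inr (Or.inl (inRay_iff.2 ⟨s + t * r, by linarith, ?_⟩))
            rw [hw, smul_smul, add_smul]
    · left
      refine ⟨h, ?_, ?_⟩
      · have : area (s • u + t • w) w = s * area u w := by simp [area]; ring
        rw [this]; nlinarith [mul_self_nonneg (area u w)]
      · have : area u (s • u + t • w) = t * area u w := by simp [area]; ring
        rw [this]; nlinarith [mul_self_nonneg (area u w)]

/-! ### Cones and Carathéodory's theorem in the plane. -/

/-- The cone spanned by a set of vectors. -/
abbrev cone (S : Set Plane) : Submodule NNReal Plane := Submodule.span NNReal S

theorem smul_mem_cone {S : Set Plane} {s : ℝ} (hs : 0 ≤ s) {y : Plane} (hy : y ∈ cone S) :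
    s • y ∈ cone S :=
  (cone S).smul_mem (⟨s, hs⟩ : NNReal) hy

theorem InCone.mem_cone {S : Set Plane} {u w y : Plane} (h : InCone u w y) (hu : u ∈ cone S)
    (hw : w ∈ cone S) : y ∈ cone S := by
  obtain ⟨s, t, hs, ht, rfl⟩ := inCone_iff.1 h
  exact add_mem (smul_mem_cone hs hu) (smul_mem_cone ht hw)

/-- If one coefficient of a linear relation is positive, the smallest ratio removes a vector. -/
theorem exists_remove_of_relation {u w g : Plane} {r s t a b c : ℝ} (hr : 0 ≤ r) (hs : 0 ≤ s)
    (ht : 0 ≤ t) (h : a • u + b • w + c • g = 0) (ha : 0 < a)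
    (hb : 0 < b → r * b ≤ s * a) (hc : 0 < c → r * c ≤ t * a) :
    InCone w g (r • u + s • w + t • g) := by
  have key : ∀ {x y : ℝ}, 0 ≤ y → (0 < x → r * x ≤ y * a) → 0 ≤ y - r / a * x := by
    intro x y hy hx
    by_cases h0 : 0 < x
    · have := hx h0
      rw [sub_nonneg, div_mul_eq_mul_div, div_le_iff₀ ha]
      exact this
    · have : r / a * x ≤ 0 := mul_nonpos_of_nonneg_of_nonpos (by positivity) (not_lt.1 h0)
      linarith
  -- Subtracting `r / a` times the relation cancels the coefficient of `u`; minimality of the ratio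
  -- `r / a` keeps the other two nonnegative.
  refine inCone_iff.2 ⟨s - r / a * b, t - r / a * c, key hs hb, key ht hc, ?_⟩
  have h' : r • u = -((r / a * b) • w + (r / a * c) • g) := by
    have := congrArg (fun z => (r / a) • z) h
    simp only [smul_add, smul_smul, smul_zero] at this
    rw [div_mul_cancel₀ _ ha.ne'] at this
    rw [eq_neg_iff_add_eq_zero, ← this]
    abel
  rw [h', sub_smul, sub_smul]
  abel

/-- This is the elimination step of Carathéodory's argument: among the vectors with positive
coefficient in the relation, the one with the smallest ratio of weight to coefficient can be
removed. -/
theorem exists_pair_of_relation {u w g : Plane} {r s t a b c : ℝ} (hr : 0 ≤ r) (hs : 0 ≤ s)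
    (ht : 0 ≤ t) (h : a • u + b • w + c • g = 0) (hpos : 0 < a ∨ 0 < b ∨ 0 < c) :
    ∃ x ∈ ({u, w, g} : Set Plane), ∃ y ∈ ({u, w, g} : Set Plane),
      InCone x y (r • u + s • w + t • g) := by
  -- one of the three vectors has the smallest ratio
  have h3 : (0 < a ∧ (0 < b → r * b ≤ s * a) ∧ (0 < c → r * c ≤ t * a)) ∨
      (0 < b ∧ (0 < a → s * a ≤ r * b) ∧ (0 < c → s * c ≤ t * b)) ∨
      (0 < c ∧ (0 < a → t * a ≤ r * c) ∧ (0 < b → t * b ≤ s * c)) := by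
    -- Transitivity of the order of the ratios, with denominators cleared.
    have cmp : ∀ {x y z p q o : ℝ}, 0 < x → 0 < y → 0 < z → p * y ≤ q * x → q * z ≤ o * y →
        p * z ≤ o * x := by
      intro x y z p q o hx hy hz h1 h2
      have : (p * z) * y ≤ (o * x) * y := by nlinarith
      exact le_of_mul_le_mul_right this hy
    by_cases ha : 0 < a <;> by_cases hb : 0 < b <;> by_cases hc : 0 < c
    · rcases le_total (r * b) (s * a) with h1 | h1 <;>
      rcases le_total (r * c) (t * a) with h2 | h2 <;>
      rcases le_total (s * c) (t * b) with h3 | h3 <;>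
      first
        | exact Or.inl ⟨ha, fun _ => h1, fun _ => h2⟩
        | exact Or.inr (Or.inl ⟨hb, fun _ => h1, fun _ => h3⟩)
        | exact Or.inr (Or.inr ⟨hc, fun _ => h2, fun _ => h3⟩)
        | exact Or.inr (Or.inl ⟨hb, fun _ => h1, fun _ => cmp hb ha hc h1 h2⟩)
        | exact Or.inl ⟨ha, fun _ => h1, fun _ => cmp ha hb hc h1 h3⟩
    · rcases le_total (r * b) (s * a) with h1 | h1
      · exact Or.inl ⟨ha, fun _ => h1, fun h => absurd h hc⟩
      · exact Or.inr (Or.inl ⟨hb, fun _ => h1, fun h => absurd h hc⟩)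
    · rcases le_total (r * c) (t * a) with h1 | h1
      · exact Or.inl ⟨ha, fun h => absurd h hb, fun _ => h1⟩
      · exact Or.inr (Or.inr ⟨hc, fun _ => h1, fun h => absurd h hb⟩)
    · exact Or.inl ⟨ha, fun h => absurd h hb, fun h => absurd h hc⟩
    · rcases le_total (s * c) (t * b) with h1 | h1
      · exact Or.inr (Or.inl ⟨hb, fun h => absurd h ha, fun _ => h1⟩)
      · exact Or.inr (Or.inr ⟨hc, fun h => absurd h ha, fun _ => h1⟩)
    · exact Or.inr (Or.inl ⟨hb, fun h => absurd h ha, fun h => absurd h hc⟩)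
    · exact Or.inr (Or.inr ⟨hc, fun h => absurd h ha, fun h => absurd h hb⟩)
    · simp_all
  rcases h3 with ⟨h0, h1, h2⟩ | ⟨h0, h1, h2⟩ | ⟨h0, h1, h2⟩
  · exact ⟨w, by simp, g, by simp, exists_remove_of_relation hr hs ht h h0 h1 h2⟩
  · refine ⟨u, by simp, g, by simp, ?_⟩
    rw [add_comm (r • u)]
    exact exists_remove_of_relation hs hr ht (by rw [← h]; abel) h0 h1 h2
  · refine ⟨u, by simp, w, by simp, ?_⟩
    rw [add_comm (r • u + s • w), ← add_assoc]
    exact exists_remove_of_relation ht hr hs (by rw [← h]; abel) h0 h1 h2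

/-- In the plane, a combination of three vectors is in the cone of two of them. -/
theorem exists_pair_of_three {u w g : Plane} {r s t : ℝ} (hr : 0 ≤ r) (hs : 0 ≤ s)
    (ht : 0 ≤ t) : ∃ x ∈ ({u, w, g} : Set Plane), ∃ y ∈ ({u, w, g} : Set Plane),
      InCone x y (r • u + s • w + t • g) := by
  -- Any three vectors of the plane satisfy this relation; it is nontrivial unless all three are
  -- parallel.
  have hrel : area w g • u + area g u • w + area u w • g = 0 := by
    apply plane_ext <;> simp [area] <;> ring
  by_cases h0 : area w g = 0 ∧ area g u = 0 ∧ area u w = 0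
  · -- all vectors are parallel
    obtain ⟨h1, h2, h3⟩ := h0
    by_cases hu : u = 0
    · exact ⟨w, by simp, g, by simp, inCone_iff.2 ⟨s, t, hs, ht, by simp [hu]⟩⟩
    · have hu' : 0 < dot u u := by
        by_contra h
        exact hu (dot_self_eq_zero (not_lt.1 h))
      have hrel' : (-dot u w) • u + dot u u • w + (0 : ℝ) • g = 0 := by
        unfold area at h3
        apply plane_ext <;> simp <;> unfold dot
        · linear_combination (- u 1) * h3
        · linear_combination (u 0) * h3
      exact exists_pair_of_relation hr hs ht hrel' (Or.inr (Or.inl hu'))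
  · by_cases hpos : 0 < area w g ∨ 0 < area g u ∨ 0 < area u w
    · exact exists_pair_of_relation hr hs ht hrel hpos
    · push Not at hpos
      -- No coefficient is positive, but some coefficient is nonzero, so the negated relation has a
      -- positive one.
      refine exists_pair_of_relation (a := -area w g) (b := -area g u) (c := -area u w)
        hr hs ht ?_ ?_
      · rw [neg_smul, neg_smul, neg_smul, ← neg_add, ← neg_add, hrel, neg_zero]
      · by_contra h
        push Not at h
        exact h0 ⟨by linarith, by linarith, by linarith⟩

/-- Carathéodory's theorem for planar cones. -/
theorem mem_cone_iff {S : Set Plane} (hS : S.Nonempty) {y : Plane} :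
    y ∈ cone S ↔ ∃ u ∈ S, ∃ w ∈ S, InCone u w y := by
  constructor
  · intro h
    induction h using Submodule.span_induction with
    | mem x hx => exact ⟨x, hx, x, hx, inCone_iff.2 ⟨1, 0, by simp, le_rfl, by simp⟩⟩
    | zero =>
      obtain ⟨x, hx⟩ := hS
      exact ⟨x, hx, x, hx, inCone_iff.2 ⟨0, 0, le_rfl, le_rfl, by simp⟩⟩
    | smul a x _ ih =>
      obtain ⟨u, hu, w, hw, h⟩ := ih
      obtain ⟨s, t, hs, ht, rfl⟩ := inCone_iff.1 h
      refine ⟨u, hu, w, hw, inCone_iff.2 ⟨a * s, a * t, by positivity, by positivity, ?_⟩⟩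
      rw [NNReal.smul_def, smul_add, smul_smul, smul_smul]
    | add x z _ _ ih1 ih2 =>
      obtain ⟨u, hu, w, hw, h⟩ := ih1
      obtain ⟨u', hu', w', hw', h'⟩ := ih2
      obtain ⟨s, t, hs, ht, rfl⟩ := inCone_iff.1 h
      obtain ⟨s', t', hs', ht', rfl⟩ := inCone_iff.1 h'
      -- The sum involves four generators; two eliminations, of one vector each, leave a pair.
      obtain ⟨a, ha, b, hb, hab⟩ := exists_pair_of_three (u := u) (w := w) (g := u') hs ht hs'
      obtain ⟨c, d, hc, hd, hcd⟩ := inCone_iff.1 hab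
      obtain ⟨a', ha', b', hb', hab'⟩ := exists_pair_of_three (u := a) (w := b) (g := w') hc hd ht'
      have haS : a ∈ S := by rcases ha with rfl | rfl | rfl <;> assumption
      have hbS : b ∈ S := by rcases hb with rfl | rfl | rfl <;> assumption
      refine ⟨a', ?_, b', ?_, ?_⟩
      · rcases ha' with rfl | rfl | rfl <;> assumption
      · rcases hb' with rfl | rfl | rfl <;> assumption
      · rw [← add_assoc, hcd]; exact hab'
  · rintro ⟨u, hu, w, hw, h⟩
    exact h.mem_cone (Submodule.subset_span hu) (Submodule.subset_span hw)

/-- A finite family of vectors in a halfplane is contained in the cone spanned by at most four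
of them. -/
theorem exists_extremal {κ : Type*} [DecidableEq κ] {v : Plane} (hv : ‖v‖ = 1) (J : Finset κ)
    (g : κ → Plane) (hg : ∀ j ∈ J, 0 ≤ dot v (g j)) :
    ∃ T ⊆ J, T.card ≤ 4 ∧ ∀ j ∈ J, g j ∈ cone (g '' T) := by
  have hv1 : v 0 * v 0 + v 1 * v 1 = 1 := by
    have := real_inner_self_eq_norm_sq v
    rw [inner_eq_dot, hv] at this
    simpa [dot] using this
  -- `dot v` and `area v` are the coordinates in the orthonormal basis given by `v` and its rotation
  -- by a right angle.
  have hext : ∀ {x y : Plane}, dot v x = dot v y → area v x = area v y → x = y := by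
    intro x y h1 h2
    unfold dot at h1
    unfold area at h2
    apply plane_ext
    · linear_combination (v 0) * h1 - (v 1) * h2 - (x 0 - y 0) * hv1
    · linear_combination (v 1) * h1 + (v 0) * h2 - (x 1 - y 1) * hv1
  have dot_add : ∀ x y : Plane, dot v (x + y) = dot v x + dot v y := by
    intro x y; simp [dot]; ring
  have area_add : ∀ x y : Plane, area v (x + y) = area v x + area v y := by
    intro x y; simp [area]; ring
  have dot_smul : ∀ (s : ℝ) (x : Plane), dot v (s • x) = s * dot v x := by
    intro s x; simp [dot]; ring
  have area_smul : ∀ (s : ℝ) (x : Plane), area v (s • x) = s * area v x := by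
    intro s x; simp [area]; ring
  -- the vectors in the interior of the halfplane
  have h1 : ∃ T ⊆ J, T.card ≤ 2 ∧ ∀ j ∈ J, 0 < dot v (g j) → g j ∈ cone (g '' T) := by
    set P := J.filter (fun j => 0 < dot v (g j)) with hP
    rcases P.eq_empty_or_nonempty with he | hne
    · refine ⟨∅, by simp, by simp, fun j hj h0 => ?_⟩
      have : j ∈ P := by simp [hP, hj, h0]
      simp [he] at this
    -- Inside the open halfplane the slope orders the directions, so the vectors of extreme slope
    -- span all the others.
    · set σ : κ → ℝ := fun j => area v (g j) / dot v (g j) with hσ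
      obtain ⟨a, ha, hmin⟩ := P.exists_min_image σ hne
      obtain ⟨b, hb, hmax⟩ := P.exists_max_image σ hne
      have ha0 := (Finset.mem_filter.1 ha).2
      have hb0 := (Finset.mem_filter.1 hb).2
      refine ⟨{a, b}, ?_, Finset.card_le_two, fun j hj h0 => ?_⟩
      · intro x hx
        simp only [Finset.mem_insert, Finset.mem_singleton] at hx
        rcases hx with rfl | rfl
        · exact (Finset.mem_filter.1 ha).1
        · exact (Finset.mem_filter.1 hb).1
      · have hjP : j ∈ P := by simp [hP, hj, h0]
        have haS : g a ∈ cone (g '' (({a, b} : Finset κ) : Set κ)) :=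
          Submodule.subset_span ⟨a, by simp, rfl⟩
        have hbS : g b ∈ cone (g '' (({a, b} : Finset κ) : Set κ)) :=
          Submodule.subset_span ⟨b, by simp, rfl⟩
        have h1 := hmin j hjP
        have h2 := hmax j hjP
        have ea : area v (g a) = σ a * dot v (g a) := by rw [hσ]; field_simp
        have eb : area v (g b) = σ b * dot v (g b) := by rw [hσ]; field_simp
        have ej : area v (g j) = σ j * dot v (g j) := by rw [hσ]; field_simp
        rcases (h1.trans h2).eq_or_lt with hab | hab
        · have : g j = (dot v (g j) / dot v (g a)) • g a := by
            apply hext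
            · rw [dot_smul]; field_simp
            · have hja : σ j = σ a := le_antisymm (hab ▸ h2) h1
              rw [area_smul, ej, ea, hja]; field_simp
          rw [this]
          exact smul_mem_cone (by positivity) haS
        · have hd : 0 < σ b - σ a := by linarith
          -- The slope `σ j` is a convex combination of `σ a` and `σ b`; the weights are rescaled by
          -- the `dot v` coordinates.
          have : g j = (dot v (g j) * (σ b - σ j) / (σ b - σ a) / dot v (g a)) • g a +
              (dot v (g j) * (σ j - σ a) / (σ b - σ a) / dot v (g b)) • g b := by
            apply hext
            · rw [dot_add, dot_smul, dot_smul]; field_simp; ring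
            · rw [area_add, area_smul, area_smul, ej, ea, eb]; field_simp; ring
          rw [this]
          have h3 : 0 ≤ σ b - σ j := by linarith
          have h4 : 0 ≤ σ j - σ a := by linarith
          exact add_mem (smul_mem_cone (by positivity) haS) (smul_mem_cone (by positivity) hbS)
  -- the vectors on the boundary, in either direction
  have h2 : ∀ ε : ℝ, ∃ T ⊆ J, T.card ≤ 1 ∧
      ∀ j ∈ J, dot v (g j) = 0 → 0 < ε * area v (g j) → g j ∈ cone (g '' T) := by
    intro ε
    by_cases h : ∃ d ∈ J, dot v (g d) = 0 ∧ 0 < ε * area v (g d)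
    · obtain ⟨d, hd, hd0, hd1⟩ := h
      refine ⟨{d}, by simpa using hd, by simp, fun j hj h0 h1 => ?_⟩
      have hne : area v (g d) ≠ 0 := by rintro h; simp [h] at hd1
      have hε : ε ≠ 0 := by rintro h; simp [h] at hd1
      have : g j = (ε * area v (g j) / (ε * area v (g d))) • g d := by
        apply hext
        · rw [dot_smul, h0, hd0]; ring
        · rw [area_smul]; field_simp
      rw [this]
      exact smul_mem_cone (by positivity) (Submodule.subset_span ⟨d, by simp, rfl⟩)
    · push Not at h
      exact ⟨∅, by simp, by simp, fun j hj h0 h1 => absurd h1 (not_lt.2 (h j hj h0))⟩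
  obtain ⟨T1, hT1, c1, H1⟩ := h1
  -- The signs `1` and `-1` select the two boundary rays: two interior vectors and one for each ray
  -- make four.
  obtain ⟨T2, hT2, c2, H2⟩ := h2 1
  obtain ⟨T3, hT3, c3, H3⟩ := h2 (-1)
  have mono : ∀ {A B : Finset κ}, A ⊆ B → cone (g '' A) ≤ cone (g '' B) := fun h =>
    Submodule.span_mono (Set.image_mono (by exact_mod_cast h))
  refine ⟨T1 ∪ T2 ∪ T3, ?_, ?_, fun j hj => ?_⟩
  · exact Finset.union_subset (Finset.union_subset hT1 hT2) hT3
  · have := Finset.card_union_le (T1 ∪ T2) T3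
    have := Finset.card_union_le T1 T2
    omega
  · rcases (hg j hj).eq_or_lt with h0 | h0
    · rcases lt_trichotomy (area v (g j)) 0 with h | h | h
      · exact mono Finset.subset_union_right (H3 j hj h0.symm (by linarith))
      · have : g j = 0 := by
          apply hext
          · rw [← h0]; simp [dot]
          · rw [h]; simp [area]
        rw [this]
        exact zero_mem _
      · exact mono (Finset.subset_union_right.trans Finset.subset_union_left)
          (H2 j hj h0.symm (by linarith))
    · exact mono (Finset.subset_union_left.trans Finset.subset_union_left) (H1 j hj h0)


/-! ### Inference from labels and comparisons -/

/-- The directions in which a halfspace is known to increase from comparisons on `P`. -/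
def gens (h : Halfspace) (P : Set Plane) : Set Plane :=
  {y | ∃ a ∈ P, ∃ b ∈ P, h.compare a b = true ∧ y = a - b}

/-- The vector that must lie in the known cone for `x` to inherit the label `r` from `q`. -/
noncomputable def gap (r : Bool) (x q : Plane) : Plane := if r then x - q else q - x

/-- The label `r` of `x` follows from labels and comparisons on `P`. -/
def Known (h : Halfspace) (P : Set Plane) (r : Bool) (x : Plane) : Prop :=
  ∃ q ∈ P, h.label q = r ∧ gap r x q ∈ cone (gens h P)

theorem compare_iff {h : Halfspace} {a b : Plane} :
    h.compare a b = true ↔ 0 ≤ dot h.normal (a - b) := by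
  have : dot h.normal (a - b) = dot h.normal a - dot h.normal b := by simp [dot]; ring
  simp [Halfspace.compare, inner_eq_dot, this]

theorem compare_self (h : Halfspace) (a : Plane) : h.compare a a = true := by
  simp [Halfspace.compare]

/-- Comparing a point with itself contributes the zero vector, so even a single point meets the
nonemptiness condition of `mem_cone_iff`. -/
theorem gens_nonempty {h : Halfspace} {P : Set Plane} (hP : P.Nonempty) : (gens h P).Nonempty := by
  obtain ⟨a, ha⟩ := hP
  exact ⟨a - a, a, ha, a, ha, compare_self h a, rfl⟩

theorem gens_mono {h : Halfspace} {P Q : Set Plane} (hPQ : P ⊆ Q) : gens h P ⊆ gens h Q := by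
  rintro y ⟨a, ha, b, hb, hab, rfl⟩
  exact ⟨a, hPQ ha, b, hPQ hb, hab, rfl⟩

theorem Known.mono {h : Halfspace} {P Q : Set Plane} {r : Bool} {x : Plane} (hPQ : P ⊆ Q)
    (hx : Known h P r x) : Known h Q r x := by
  obtain ⟨q, hq, hr, hc⟩ := hx
  exact ⟨q, hPQ hq, hr, Submodule.span_mono (gens_mono hPQ) hc⟩

theorem dot_nonneg_of_mem_cone {h : Halfspace} {P : Set Plane} {y : Plane}
    (hy : y ∈ cone (gens h P)) : 0 ≤ dot h.normal y := by
  induction hy using Submodule.span_induction with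
  | mem x hx =>
    obtain ⟨a, -, b, -, hab, rfl⟩ := hx
    exact compare_iff.1 hab
  | zero => simp [dot]
  | add x y _ _ hx hy =>
    have : dot h.normal (x + y) = dot h.normal x + dot h.normal y := by simp [dot]; ring
    rw [this]; positivity
  | smul a x _ hx =>
    have : dot h.normal (a • x) = (a : ℝ) * dot h.normal x := by
      simp [dot, NNReal.smul_def]; ring
    rw [this]; positivity

/-- Inference is sound. -/
theorem Known.label_eq {h : Halfspace} {P : Set Plane} {r : Bool} {x : Plane}
    (hx : Known h P r x) : h.label x = r := by
  obtain ⟨q, -, hr, hc⟩ := hx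
  have h0 := dot_nonneg_of_mem_cone hc
  cases r
  · have h1 : dot h.normal (gap false x q) = dot h.normal q - dot h.normal x := by
      simp [gap, dot]; ring
    simp only [Halfspace.label, inner_eq_dot, decide_eq_false_iff_not, not_le] at hr ⊢
    linarith
  · have h1 : dot h.normal (gap true x q) = dot h.normal x - dot h.normal q := by
      simp [gap, dot]; ring
    simp only [Halfspace.label, inner_eq_dot, decide_eq_true_eq] at hr ⊢
    linarith

theorem gap_add (r : Bool) (x y z : Plane) : gap r x z = gap r x y + gap r y z := by
  cases r <;> simp [gap]

/-- If `Q` yields all directions and all labels of `P`, then it yields all inferences from `P`. -/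
theorem Known.of_generated {h : Halfspace} {P Q : Set Plane}
    (hg : gens h P ⊆ cone (gens h Q)) (hl : ∀ q ∈ P, Known h Q (h.label q) q)
    {r : Bool} {x : Plane} (hx : Known h P r x) : Known h Q r x := by
  obtain ⟨q, hq, hr, hc⟩ := hx
  obtain ⟨q', hq', hr', hc'⟩ := hl q hq
  refine ⟨q', hq', hr'.trans hr, ?_⟩
  rw [gap_add r x q q']
  rw [hr] at hc'
  exact add_mem (Submodule.span_le.2 hg hc) hc'

/-! ### Inference as a finite combination of sign conditions -/

section Indexed

variable {ι : Type*}

/-- `y` is in the cone of two directions that are known from the comparisons `cmp` on the points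
with index in `A`. -/
def Spans (A : Set ι) (p : ι → Plane) (cmp : ι → ι → Bool) (y : Plane) : Prop :=
  ∃ a, ∃ b, ∃ c, ∃ d, ((a ∈ A ∧ b ∈ A ∧ cmp a b = true) ∧ c ∈ A ∧ d ∈ A ∧ cmp c d = true) ∧
    InCone (p a - p b) (p c - p d) y

/-- The label `r` of `x` follows from the labels `lab` and the comparisons `cmp` on the points
with index in `A`. -/
def Infers (A : Set ι) (p : ι → Plane) (lab : ι → Bool) (cmp : ι → ι → Bool) (r : Bool)
    (x : Plane) : Prop :=
  ∃ i, (i ∈ A ∧ lab i = r) ∧ Spans A p cmp (gap r x (p i))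

/-- The point with index `i` can be forgotten without loss. -/
def Removable (p : ι → Plane) (lab : ι → Bool) (cmp : ι → ι → Bool) (i : ι) : Prop :=
  (∀ a b, cmp a b = true → Spans {i}ᶜ p cmp (p a - p b)) ∧ Infers {i}ᶜ p lab cmp (lab i) (p i)

open Classical in
/-- The classifier: the label of `x` if it can be inferred. -/
noncomputable def infer (p : ι → Plane) (lab : ι → Bool) (cmp : ι → ι → Bool) (x : Plane) :
    Option Bool :=
  if Infers Set.univ p lab cmp true x then some true
  else if Infers Set.univ p lab cmp false x then some false else none

/-- By Carathéodory, membership in a cone with arbitrarily many generators becomes a search over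
pairs of comparisons, which a decision tree can perform. -/
theorem spans_iff {h : Halfspace} {A : Set ι} (hA : A.Nonempty) {p : ι → Plane} {y : Plane} :
    Spans A p (fun i j => h.compare (p i) (p j)) y ↔ y ∈ cone (gens h (p '' A)) := by
  rw [mem_cone_iff (gens_nonempty (hA.image p))]
  constructor
  · rintro ⟨a, b, c, d, ⟨⟨ha, hb, hab⟩, hc, hd, hcd⟩, hy⟩
    exact ⟨_, ⟨p a, ⟨a, ha, rfl⟩, p b, ⟨b, hb, rfl⟩, hab, rfl⟩,
      _, ⟨p c, ⟨c, hc, rfl⟩, p d, ⟨d, hd, rfl⟩, hcd, rfl⟩, hy⟩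
  · rintro ⟨_, ⟨_, ⟨a, ha, rfl⟩, _, ⟨b, hb, rfl⟩, hab, rfl⟩,
      _, ⟨_, ⟨c, hc, rfl⟩, _, ⟨d, hd, rfl⟩, hcd, rfl⟩, hy⟩
    exact ⟨a, b, c, d, ⟨⟨ha, hb, hab⟩, hc, hd, hcd⟩, hy⟩

theorem infers_iff {h : Halfspace} {A : Set ι} {p : ι → Plane} {r : Bool} {x : Plane} :
    Infers A p (fun i => h.label (p i)) (fun i j => h.compare (p i) (p j)) r x ↔
      Known h (p '' A) r x := by
  constructor
  · rintro ⟨i, ⟨hi, hr⟩, hs⟩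
    exact ⟨p i, ⟨i, hi, rfl⟩, hr, (spans_iff ⟨i, hi⟩).1 hs⟩
  · rintro ⟨_, ⟨i, hi, rfl⟩, hr, hs⟩
    exact ⟨i, ⟨hi, hr⟩, (spans_iff ⟨i, hi⟩).2 hs⟩

theorem infer_eq_some {h : Halfspace} {p : ι → Plane} {x : Plane} {r : Bool}
    (hr : infer p (fun i => h.label (p i)) (fun i j => h.compare (p i) (p j)) x = some r) :
    h.label x = r := by
  unfold infer at hr
  split_ifs at hr with h1 h2
  · rw [← Option.some.inj hr]; exact (infers_iff.1 h1).label_eq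
  · rw [← Option.some.inj hr]; exact (infers_iff.1 h2).label_eq

theorem infer_eq_none {h : Halfspace} {p : ι → Plane} {x : Plane} :
    infer p (fun i => h.label (p i)) (fun i j => h.compare (p i) (p j)) x = none ↔
      ∀ r, ¬ Known h (Set.range p) r x := by
  rw [← Set.image_univ]
  simp only [← infers_iff, Bool.forall_bool]
  unfold infer
  split_ifs <;> simp_all

/-- The remaining points generate all old directions and yield the label of the removed point, so
`Known.of_generated` transfers every inference. -/
theorem Removable.known {h : Halfspace} {p : ι → Plane} {i : ι}
    (hi : Removable p (fun i => h.label (p i)) (fun i j => h.compare (p i) (p j)) i)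
    {r : Bool} {x : Plane} (hx : Known h (Set.range p) r x) : Known h (p '' {i}ᶜ) r x := by
  obtain ⟨hi1, hi2⟩ := hi
  have hne : ({i}ᶜ : Set ι).Nonempty := by
    obtain ⟨j, ⟨hj, -⟩, -⟩ := hi2
    exact ⟨j, hj⟩
  refine hx.of_generated ?_ ?_
  · rintro _ ⟨_, ⟨a, rfl⟩, _, ⟨b, rfl⟩, hab, rfl⟩
    exact (spans_iff hne).1 (hi1 a b hab)
  · rintro _ ⟨j, rfl⟩
    by_cases hj : j = i
    · subst hj; exact infers_iff.1 hi2
    · refine ⟨p j, ⟨j, hj, rfl⟩, rfl, ?_⟩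
      have : gap (h.label (p j)) (p j) (p j) = 0 := by simp [gap]
      rw [this]
      exact zero_mem _

/-! ### How many points of a finite sample are essential. -/

variable [Fintype ι]

/-- Among the points with label `r` there is one that is closest to the boundary. -/
theorem exists_closest (h : Halfspace) (p : ι → Plane) (r : Bool) :
    ∃ I : Finset ι, I.card ≤ 1 ∧ ∀ j, h.label (p j) = r →
      ∃ i ∈ I, h.label (p i) = r ∧ 0 ≤ dot h.normal (gap r (p j) (p i)) := by
  set J := Finset.univ.filter (fun j => h.label (p j) = r) with hJ
  rcases J.eq_empty_or_nonempty with he | hne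
  · refine ⟨∅, by simp, fun j hj => ?_⟩
    have : j ∈ J := by simp [hJ, hj]
    simp [he] at this
  · obtain ⟨i, hi, hmin⟩ := J.exists_min_image (fun j => dot h.normal (gap r (p j) 0)) hne
    refine ⟨{i}, by simp, fun j hj => ⟨i, by simp, by simpa [hJ] using hi, ?_⟩⟩
    have h1 := hmin j (by simp [hJ, hj])
    have h2 : ∀ x : Plane, dot h.normal (gap r x 0) + dot h.normal (gap r 0 (p i)) =
        dot h.normal (gap r x (p i)) := by
      intro x
      rw [gap_add r x 0 (p i)]
      simp [dot]; ring
    have h3 : dot h.normal (gap r (p i) (p i)) = 0 := by simp [gap, dot]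
    rw [← h2] at h3 ⊢
    linarith

theorem gap_mem_gens {h : Halfspace} {P : Set Plane} {r : Bool} {x q : Plane} (hx : x ∈ P)
    (hq : q ∈ P) (hd : 0 ≤ dot h.normal (gap r x q)) : gap r x q ∈ gens h P := by
  cases r
  · exact ⟨q, hq, x, hx, compare_iff.2 hd, rfl⟩
  · exact ⟨x, hx, q, hq, compare_iff.2 hd, rfl⟩

variable [DecidableEq ι]

/-- Among more than ten points, one can be forgotten without loss. -/
theorem exists_removable (h : Halfspace) (p : ι → Plane) (hn : 10 < Fintype.card ι) :
    ∃ i, Removable p (fun i => h.label (p i)) (fun i j => h.compare (p i) (p j)) i := by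
  obtain ⟨T, hTJ, hT4, hT⟩ := exists_extremal h.norm_normal
    (Finset.univ.filter (fun c : ι × ι => h.compare (p c.1) (p c.2) = true))
    (fun c => p c.1 - p c.2) (fun j hj => compare_iff.1 (by simpa using hj))
  obtain ⟨I, hI1, hI⟩ := exists_closest h p true
  obtain ⟨I', hI1', hI'⟩ := exists_closest h p false
  -- Four differences have at most eight endpoints, and each label contributes one closest point:
  -- ten in all.
  have hcard : ((T.image Prod.fst ∪ T.image Prod.snd) ∪ (I ∪ I')).card < Fintype.card ι := by
    have h1 := Finset.card_union_le (T.image Prod.fst ∪ T.image Prod.snd) (I ∪ I')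
    have h2 := Finset.card_union_le (T.image Prod.fst) (T.image Prod.snd)
    have h3 := Finset.card_union_le I I'
    have h4 : (T.image Prod.fst).card ≤ T.card := Finset.card_image_le
    have h5 : (T.image Prod.snd).card ≤ T.card := Finset.card_image_le
    omega
  obtain ⟨i, hi⟩ : ∃ i, i ∉ (T.image Prod.fst ∪ T.image Prod.snd) ∪ (I ∪ I') := by
    by_contra hcon
    push Not at hcon
    rw [Finset.eq_univ_of_forall hcon, Finset.card_univ] at hcard
    exact lt_irrefl _ hcard
  simp only [Finset.mem_union, Finset.mem_image, not_or, not_exists, not_and] at hi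
  obtain ⟨⟨hi1, hi2⟩, hi3, hi4⟩ := hi
  -- Since `i` is not the selected closest point of its label, that point remains and passes its
  -- label on to `i`.
  have hclose : ∃ q ∈ ({i}ᶜ : Set ι), h.label (p q) = h.label (p i) ∧
      0 ≤ dot h.normal (gap (h.label (p i)) (p i) (p q)) := by
    rcases hb : h.label (p i) with _ | _
    · obtain ⟨q, hq, hq1, hq2⟩ := hI' i hb
      exact ⟨q, fun e => hi4 (e ▸ hq), hq1, hq2⟩
    · obtain ⟨q, hq, hq1, hq2⟩ := hI i hb
      exact ⟨q, fun e => hi3 (e ▸ hq), hq1, hq2⟩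
  obtain ⟨q, hq, hq1, hq2⟩ := hclose
  have hgen : gens h (Set.range p) ⊆ cone (gens h (p '' {i}ᶜ)) := by
    rintro _ ⟨_, ⟨a, rfl⟩, _, ⟨b, rfl⟩, hab, rfl⟩
    refine Submodule.span_mono ?_ (hT (a, b) (by simpa using hab))
    rintro _ ⟨⟨c, d⟩, hcd, rfl⟩
    exact ⟨p c, ⟨c, fun e => hi1 _ hcd e, rfl⟩, p d, ⟨d, fun e => hi2 _ hcd e, rfl⟩,
      by simpa using hTJ hcd, rfl⟩
  refine ⟨i, fun a b hab => (spans_iff ⟨q, hq⟩).2 (hgen ?_), infers_iff.2 ?_⟩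
  · exact ⟨p a, ⟨a, rfl⟩, p b, ⟨b, rfl⟩, hab, rfl⟩
  · exact ⟨p q, ⟨q, hq, rfl⟩, hq1, hgen (gap_mem_gens ⟨i, rfl⟩ ⟨q, rfl⟩ hq2)⟩

/-- Among points of label `r`, at most five cannot be inferred from the others. -/
theorem exists_exceptional (h : Halfspace) (p : ι → Plane) (r : Bool) :
    ∃ E : Finset ι, E.card ≤ 5 ∧ ∀ j, h.label (p j) = r → j ∉ E → Known h (p '' {j}ᶜ) r (p j) := by
  rcases isEmpty_or_nonempty ι with hι | hι
  · exact ⟨∅, by simp, fun j => hι.elim j⟩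
  obtain ⟨I, hI1, hI⟩ := exists_closest h p r
  rcases Finset.card_le_one_iff_subset_singleton.1 hI1 with ⟨i, hIi⟩
  have hi : ∀ j, h.label (p j) = r → h.label (p i) = r ∧
      0 ≤ dot h.normal (gap r (p j) (p i)) := by
    intro j hj
    obtain ⟨i', hi', H⟩ := hI j hj
    rw [Finset.mem_singleton.1 (hIi hi')] at H
    exact H
  obtain ⟨T, hTJ, hT4, hT⟩ := exists_extremal h.norm_normal
    (Finset.univ.filter (fun j => h.label (p j) = r))
    (fun j => gap r (p j) (p i)) (fun j hj => (hi j (by simpa using hj)).2)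
  -- All differences are taken to the same closest point `i`, so four extremal differences cost only
  -- four further points.
  refine ⟨insert i T, (Finset.card_insert_le i T).trans (by omega), fun j hj hjE => ?_⟩
  simp only [Finset.mem_insert, not_or] at hjE
  have hi' : p i ∈ p '' {j}ᶜ := ⟨i, fun e => hjE.1 e.symm, rfl⟩
  refine ⟨p i, hi', (hi j hj).1, Submodule.span_mono ?_ (hT j (by simpa using hj))⟩
  rintro _ ⟨k, hk, rfl⟩
  have hk' := hTJ hk
  refine gap_mem_gens ⟨k, fun e => hjE.2 (e ▸ hk), rfl⟩ hi' (hi k (by simpa using hk')).2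

open Classical in
/-- At most ten points cannot be inferred from the others. -/
theorem card_unknown_le (h : Halfspace) (p : ι → Plane) :
    (Finset.univ.filter (fun j => ∀ r, ¬ Known h (p '' {j}ᶜ) r (p j))).card ≤ 10 := by
  obtain ⟨E, hE, HE⟩ := exists_exceptional h p true
  obtain ⟨E', hE', HE'⟩ := exists_exceptional h p false
  refine (Finset.card_le_card (t := E ∪ E') fun j hj => ?_).trans
    ((Finset.card_union_le E E').trans (by omega))
  have hj' := (Finset.mem_filter.1 hj).2
  rw [Finset.mem_union]
  by_contra hcon
  rw [not_or] at hcon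
  rcases hb : h.label (p j) with _ | _
  · exact hj' _ (HE' j hb hcon.2)
  · exact hj' _ (HE j hb hcon.1)

end Indexed


/-! ### Functions computed by algebraic decision trees -/

namespace DecisionTree

variable {ι κ α β : Type}

/-- Run a second tree that depends on the result of the first. -/
def bind (t : DecisionTree ι α) (g : α → DecisionTree ι β) : DecisionTree ι β :=
  match t with
  | .leaf a => g a
  | .branch e yes no => .branch e (yes.bind g) (no.bind g)

theorem eval_bind (p : ι → Plane) (t : DecisionTree ι α) (g : α → DecisionTree ι β) :
    (t.bind g).eval p = (g (t.eval p)).eval p := by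
  induction t with
  | leaf a => rfl
  | branch e yes no h1 h2 => simp only [bind, eval]; split_ifs <;> assumption

/-- Change the results at the leaves. -/
def map (g : α → β) : DecisionTree ι α → DecisionTree ι β
  | .leaf a => .leaf (g a)
  | .branch e yes no => .branch e (yes.map g) (no.map g)

theorem eval_map (p : ι → Plane) (t : DecisionTree ι α) (g : α → β) :
    (t.map g).eval p = g (t.eval p) := by
  induction t with
  | leaf a => rfl
  | branch e yes no h1 h2 => simp only [map, eval]; split_ifs <;> assumption

/-- Each leaf counts at least one unit in the size on the right and at most `1 + b` units after the
change of results. -/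
theorem size_map_le (t : DecisionTree ι α) (g : α → β) (len : β → ℕ) {b : ℕ}
    (hb : ∀ a, len (g a) ≤ b) : (t.map g).size len ≤ t.size (fun _ => 0) * (1 + b) := by
  induction t with
  | leaf a => simpa [map, size] using hb a
  | branch e yes no h1 h2 =>
    simp only [map, size]
    nlinarith

end DecisionTree

/-- Rename the points. -/
def Expr.rename {ι κ : Type} (f : ι → κ) : Expr ι → Expr κ
  | .one => .one
  | .coord i c => .coord (f i) c
  | .add d e => .add (d.rename f) (e.rename f)
  | .sub d e => .sub (d.rename f) (e.rename f)
  | .mul d e => .mul (d.rename f) (e.rename f)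

theorem Expr.eval_rename {ι κ : Type} (f : ι → κ) (p : κ → Plane) (e : Expr ι) :
    (e.rename f).eval p = e.eval (fun i => p (f i)) := by
  induction e <;> simp_all [Expr.rename, Expr.eval]

theorem Expr.size_rename {ι κ : Type} (f : ι → κ) (e : Expr ι) : (e.rename f).size = e.size := by
  induction e <;> simp_all [Expr.rename, Expr.size]

namespace DecisionTree

variable {ι κ α : Type}

/-- Rename the points. -/
def rename (f : ι → κ) : DecisionTree ι α → DecisionTree κ α
  | .leaf a => .leaf a
  | .branch e yes no => .branch (e.rename f) (yes.rename f) (no.rename f)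

theorem eval_rename (f : ι → κ) (p : κ → Plane) (t : DecisionTree ι α) :
    (t.rename f).eval p = t.eval (fun i => p (f i)) := by
  induction t with
  | leaf a => rfl
  | branch e yes no h1 h2 => simp only [rename, eval, Expr.eval_rename, h1, h2]

theorem size_rename (f : ι → κ) (len : α → ℕ) (t : DecisionTree ι α) :
    (t.rename f).size len = t.size len := by
  induction t with
  | leaf a => rfl
  | branch e yes no h1 h2 => simp only [rename, size, Expr.size_rename, h1, h2]

end DecisionTree

theorem Expr.measurable_eval {ι : Type} (e : Expr ι) : Measurable (fun p => e.eval p) := by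
  induction e with
  | one => exact measurable_const
  | coord i c =>
    simp only [Expr.eval]
    fun_prop
  | add d e hd he => exact hd.add he
  | sub d e hd he => exact hd.sub he
  | mul d e hd he => exact hd.mul he

theorem DecisionTree.measurable_eval {ι α : Type} [MeasurableSpace α] (t : DecisionTree ι α) :
    Measurable (fun p => t.eval p) := by
  induction t with
  | leaf a => exact measurable_const
  | branch e yes no h1 h2 =>
    simp only [DecisionTree.eval]
    exact Measurable.ite (measurableSet_le measurable_const e.measurable_eval) h1 h2

/-- Functions of points that are computed by an algebraic decision tree. -/
def IsTree {V α : Type} (f : (V → Plane) → α) : Prop :=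
  ∃ t : DecisionTree V α, ∀ p, t.eval p = f p

/-- Predicates of points that are decided by an algebraic decision tree. -/
def IsTreePred {V : Type} (S : (V → Plane) → Prop) : Prop :=
  open Classical in IsTree (fun p => decide (S p))

/-- Real functions of points that are given by an arithmetic expression. -/
def IsPoly {V : Type} (f : (V → Plane) → ℝ) : Prop := ∃ e : Expr V, ∀ p, e.eval p = f p

/-- Points whose coordinates are given by arithmetic expressions. -/
def IsPolyPoint {V : Type} (f : (V → Plane) → Plane) : Prop := ∀ c, IsPoly (fun p => f p c)

/-! ### Closure properties of functions computed by trees. -/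

section Closure

variable {V α β : Type}

theorem IsTree.const (a : α) : IsTree (fun _ : V → Plane => a) := ⟨.leaf a, fun _ => rfl⟩

theorem IsTree.bind {f : (V → Plane) → α} {g : α → (V → Plane) → β} (hf : IsTree f)
    (hg : ∀ a, IsTree (g a)) : IsTree (fun p => g (f p) p) := by
  obtain ⟨t, ht⟩ := hf
  choose u hu using hg
  exact ⟨t.bind u, fun p => by rw [DecisionTree.eval_bind, hu, ht]⟩

theorem IsTree.comp {f : (V → Plane) → α} (hf : IsTree f) (g : α → β) :
    IsTree (fun p => g (f p)) :=
  hf.bind (g := fun a _ => g a) fun a => IsTree.const (g a)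

theorem IsTree.pi {n : ℕ} {f : Fin n → (V → Plane) → α} (hf : ∀ i, IsTree (f i)) :
    IsTree (fun p i => f i p) := by
  induction n with
  | zero => exact ⟨.leaf Fin.elim0, fun p => by ext i; exact i.elim0⟩
  | succ n ih =>
    have := (hf 0).bind (g := fun a p => (Fin.cons a (fun i => f (Fin.succ i) p) : Fin (n + 1) → α))
      fun a => (ih fun i => hf i.succ).comp (fun v => (Fin.cons a v : Fin (n + 1) → α))
    refine (congrArg IsTree ?_).mp this
    funext p i
    refine Fin.cases ?_ (fun j => ?_) i <;> simp

theorem IsTree.measurable [MeasurableSpace α] {f : (V → Plane) → α} (hf : IsTree f) :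
    Measurable f := by
  obtain ⟨t, ht⟩ := hf
  rw [← funext ht]
  exact t.measurable_eval

theorem IsTreePred.not {S : (V → Plane) → Prop} (hS : IsTreePred S) :
    IsTreePred (fun p => ¬ S p) := by
  classical
  refine (congrArg IsTree ?_).mp (IsTree.comp hS (fun b => !b))
  funext p
  simp

theorem IsTreePred.and {S T : (V → Plane) → Prop} (hS : IsTreePred S) (hT : IsTreePred T) :
    IsTreePred (fun p => S p ∧ T p) := by
  classical
  refine (congrArg IsTree ?_).mp (IsTree.bind hS (fun b => IsTree.comp hT (fun c => b && c)))
  funext p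
  simp

theorem IsTreePred.or {S T : (V → Plane) → Prop} (hS : IsTreePred S) (hT : IsTreePred T) :
    IsTreePred (fun p => S p ∨ T p) := by
  classical
  refine (congrArg IsTree ?_).mp (IsTree.bind hS (fun b => IsTree.comp hT (fun c => b || c)))
  funext p
  simp

theorem IsTreePred.const (s : Prop) : IsTreePred (fun _ : V → Plane => s) := IsTree.const _

theorem IsTreePred.imp {s : Prop} {T : (V → Plane) → Prop} (hT : IsTreePred T) :
    IsTreePred (fun p => s → T p) := by
  refine (congrArg IsTreePred ?_).mp ((IsTreePred.const (¬ s)).or hT)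
  funext p
  rw [imp_iff_not_or]

theorem IsTreePred.exists {n : ℕ} {S : Fin n → (V → Plane) → Prop} (hS : ∀ i, IsTreePred (S i)) :
    IsTreePred (fun p => ∃ i, S i p) := by
  classical
  refine (congrArg IsTree ?_).mp (IsTree.comp (IsTree.pi hS) (fun v => decide (∃ i, v i = true)))
  funext p
  simp

theorem IsTreePred.forall {n : ℕ} {S : Fin n → (V → Plane) → Prop} (hS : ∀ i, IsTreePred (S i)) :
    IsTreePred (fun p => ∀ i, S i p) := by
  refine (congrArg IsTreePred ?_).mp (IsTreePred.not (IsTreePred.exists fun i => (hS i).not))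
  funext p
  simp

theorem IsPoly.add {f g : (V → Plane) → ℝ} (hf : IsPoly f) (hg : IsPoly g) :
    IsPoly (fun p => f p + g p) := by
  obtain ⟨d, hd⟩ := hf
  obtain ⟨e, he⟩ := hg
  exact ⟨.add d e, fun p => by simp only [Expr.eval, hd, he]⟩

theorem IsPoly.sub {f g : (V → Plane) → ℝ} (hf : IsPoly f) (hg : IsPoly g) :
    IsPoly (fun p => f p - g p) := by
  obtain ⟨d, hd⟩ := hf
  obtain ⟨e, he⟩ := hg
  exact ⟨.sub d e, fun p => by simp only [Expr.eval, hd, he]⟩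

theorem IsPoly.mul {f g : (V → Plane) → ℝ} (hf : IsPoly f) (hg : IsPoly g) :
    IsPoly (fun p => f p * g p) := by
  obtain ⟨d, hd⟩ := hf
  obtain ⟨e, he⟩ := hg
  exact ⟨.mul d e, fun p => by simp only [Expr.eval, hd, he]⟩

theorem IsPoly.nonneg {f : (V → Plane) → ℝ} (hf : IsPoly f) : IsTreePred (fun p => 0 ≤ f p) := by
  classical
  obtain ⟨e, he⟩ := hf
  refine ⟨.branch e (.leaf true) (.leaf false), fun p => ?_⟩
  simp only [DecisionTree.eval, he]
  split_ifs with h <;> simp [h]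

theorem IsPoly.nonpos {f : (V → Plane) → ℝ} (hf : IsPoly f) : IsTreePred (fun p => f p ≤ 0) := by
  -- The grammar has neither zero nor negation; `(f - f) - f` serves as `-f`.
  refine (congrArg IsTreePred ?_).mp ((hf.sub hf).sub hf).nonneg
  funext p
  simp

theorem IsPoly.eq_zero {f : (V → Plane) → ℝ} (hf : IsPoly f) : IsTreePred (fun p => f p = 0) := by
  refine (congrArg IsTreePred ?_).mp (hf.nonneg.and hf.nonpos)
  funext p
  exact propext ⟨fun h => le_antisymm h.2 h.1, fun h => ⟨h.ge, h.le⟩⟩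

theorem IsPolyPoint.eval (i : V) : IsPolyPoint (fun p : V → Plane => p i) :=
  fun c => ⟨.coord i c, fun _ => rfl⟩

theorem IsPolyPoint.sub {f g : (V → Plane) → Plane} (hf : IsPolyPoint f) (hg : IsPolyPoint g) :
    IsPolyPoint (fun p => f p - g p) := fun c => (hf c).sub (hg c)

theorem IsPolyPoint.gap (r : Bool) {f g : (V → Plane) → Plane} (hf : IsPolyPoint f)
    (hg : IsPolyPoint g) : IsPolyPoint (fun p => gap r (f p) (g p)) := by
  cases r
  · exact hg.sub hf
  · exact hf.sub hg

theorem IsPolyPoint.area {f g : (V → Plane) → Plane} (hf : IsPolyPoint f) (hg : IsPolyPoint g) :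
    IsPoly (fun p => area (f p) (g p)) :=
  ((hf 0).mul (hg 1)).sub ((hf 1).mul (hg 0))

theorem IsPolyPoint.dot {f g : (V → Plane) → Plane} (hf : IsPolyPoint f) (hg : IsPolyPoint g) :
    IsPoly (fun p => dot (f p) (g p)) :=
  ((hf 0).mul (hg 0)).add ((hf 1).mul (hg 1))

theorem IsPolyPoint.inRay {f g : (V → Plane) → Plane} (hf : IsPolyPoint f) (hg : IsPolyPoint g) :
    IsTreePred (fun p => InRay (f p) (g p)) :=
  (hf.area hg).eq_zero.and ((hf.dot hg).nonpos.not.or (hg.dot hg).nonpos)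

theorem IsPolyPoint.inCone {f g k : (V → Plane) → Plane} (hf : IsPolyPoint f) (hg : IsPolyPoint g)
    (hk : IsPolyPoint k) : IsTreePred (fun p => InCone (f p) (g p) (k p)) :=
  ((hf.area hg).eq_zero.not.and ((((hk.area hg).mul (hf.area hg)).nonneg).and
    (((hf.area hk).mul (hf.area hg)).nonneg))).or ((hf.inRay hk).or (hg.inRay hk))

variable {n : ℕ} {P : Fin n → (V → Plane) → Plane}

theorem isTreePred_spans (hP : ∀ i, IsPolyPoint (P i)) (A : Set (Fin n)) (cmp : Fin n → Fin n → Bool)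
    {y : (V → Plane) → Plane} (hy : IsPolyPoint y) :
    IsTreePred (fun p => Spans A (fun i => P i p) cmp (y p)) :=
  .exists fun a => .exists fun b => .exists fun c => .exists fun d =>
    (IsTreePred.const _).and (((hP a).sub (hP b)).inCone ((hP c).sub (hP d)) hy)

theorem isTreePred_infers (hP : ∀ i, IsPolyPoint (P i)) (A : Set (Fin n)) (lab : Fin n → Bool)
    (cmp : Fin n → Fin n → Bool) (r : Bool) {y : (V → Plane) → Plane} (hy : IsPolyPoint y) :
    IsTreePred (fun p => Infers A (fun i => P i p) lab cmp r (y p)) :=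
  .exists fun i => (IsTreePred.const _).and (isTreePred_spans hP A cmp (hy.gap r (hP i)))

theorem isTreePred_removable (hP : ∀ i, IsPolyPoint (P i)) (lab : Fin n → Bool)
    (cmp : Fin n → Fin n → Bool) (i : Fin n) :
    IsTreePred (fun p => Removable (fun i => P i p) lab cmp i) :=
  (IsTreePred.forall fun a => IsTreePred.forall fun b =>
    (isTreePred_spans hP _ cmp ((hP a).sub (hP b))).imp).and
      (isTreePred_infers hP _ lab cmp _ (hP i))

theorem isTree_infer (hP : ∀ i, IsPolyPoint (P i)) (lab : Fin n → Bool)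
    (cmp : Fin n → Fin n → Bool) {y : (V → Plane) → Plane} (hy : IsPolyPoint y) :
    IsTree (fun p => infer (fun i => P i p) lab cmp (y p)) := by
  classical
  refine (congrArg IsTree ?_).mp (IsTree.bind (isTreePred_infers hP Set.univ lab cmp true hy)
    (fun b => IsTree.comp (isTreePred_infers hP Set.univ lab cmp false hy)
      (fun c => if b then some true else if c then some false else none)))
  funext p
  simp [infer]

end Closure

/-! ### Trees for the classifier and for choosing a point to forget. -/

open Classical in
/-- The first point that can be forgotten. -/
noncomputable def removal {n : ℕ} (p : Fin n → Plane) (lab : Fin n → Bool)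
    (cmp : Fin n → Fin n → Bool) : ℕ :=
  if H : ∃ i, Removable p lab cmp i then (H.choose : Fin n) else 0

theorem isTree_removal {n : ℕ} (lab : Fin n → Bool) (cmp : Fin n → Fin n → Bool) :
    IsTree (fun p : Fin n → Plane => removal p lab cmp) := by
  classical
  -- The tree first decides removability of every index. The choice is then made from the resulting
  -- Boolean vector, which describes the same predicate, so the same index is chosen.
  refine (congrArg IsTree ?_).mp (IsTree.comp (IsTree.pi
    (isTreePred_removable (fun i => IsPolyPoint.eval i) lab cmp))
    (fun v => if H : ∃ i, v i = true then ((H.choose : Fin n) : ℕ) else 0))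
  funext p
  simp [removal]

/-- A tree that computes the classifier, for given labels and comparisons. -/
noncomputable def inferTree (n : ℕ) (lab : Fin n → Bool) (cmp : Fin n → Fin n → Bool) :
    DecisionTree (Option (Fin n)) (Option Bool) :=
  (isTree_infer (P := fun i (p : Option (Fin n) → Plane) => p (some i))
    (fun i => IsPolyPoint.eval (some i)) lab cmp (IsPolyPoint.eval none)).choose

theorem eval_inferTree {n : ℕ} (lab : Fin n → Bool) (cmp : Fin n → Fin n → Bool)
    (p : Option (Fin n) → Plane) :
    (inferTree n lab cmp).eval p = infer (fun i => p (some i)) lab cmp (p none) :=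
  (isTree_infer (P := fun i (p : Option (Fin n) → Plane) => p (some i))
    (fun i => IsPolyPoint.eval (some i)) lab cmp (IsPolyPoint.eval none)).choose_spec p

/-- A tree that finds a point that can be forgotten, for given labels and comparisons. -/
noncomputable def removalTree (n : ℕ) (lab : Fin n → Bool) (cmp : Fin n → Fin n → Bool) :
    DecisionTree (Fin n) ℕ :=
  (isTree_removal lab cmp).choose

theorem eval_removalTree {n : ℕ} (lab : Fin n → Bool) (cmp : Fin n → Fin n → Bool)
    (p : Fin n → Plane) : (removalTree n lab cmp).eval p = removal p lab cmp :=
  (isTree_removal lab cmp).choose_spec p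

theorem removal_lt {n : ℕ} (hn : 0 < n) (p : Fin n → Plane) (lab : Fin n → Bool)
    (cmp : Fin n → Fin n → Bool) : removal p lab cmp < n := by
  unfold removal
  split_ifs
  · exact Fin.is_lt _
  · exact hn


/-! ### Measurability on lists of points -/

/-- The measurable structure on lists that is generated by the length and the entries. -/
instance instMeasurableSpaceListPlane : MeasurableSpace (List Plane) :=
  MeasurableSpace.comap (fun l => (l.length, fun i : ℕ => l.getD i 0)) inferInstance

section Lists

variable {α β γ : Type*} [MeasurableSpace α] [MeasurableSpace β] [MeasurableSpace γ]

theorem measurable_list_repr :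
    Measurable (fun l : List Plane => (l.length, fun i : ℕ => l.getD i 0)) :=
  comap_measurable _

theorem measurable_list_length : Measurable (fun l : List Plane => l.length) :=
  measurable_list_repr.fst

theorem measurable_list_getD (i : ℕ) : Measurable (fun l : List Plane => l.getD i 0) :=
  (measurable_pi_apply i).comp measurable_list_repr.snd

theorem measurable_list_of {F : α → List Plane} (h1 : Measurable (fun a => (F a).length))
    (h2 : ∀ i, Measurable (fun a => (F a).getD i 0)) : Measurable F := by
  apply measurable_comap_iff.2
  exact h1.prodMk (measurable_pi_lambda _ h2)

/-- A measurable family indexed by a countable parameter may be evaluated at a measurable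
parameter. -/
theorem measurable_of_countable_param [Countable γ] [MeasurableSingletonClass γ] {F : γ → α → β}
    {i : α → γ} (hi : Measurable i) (hF : ∀ c, Measurable (F c)) :
    Measurable (fun a => F (i a) a) := by
  have : Measurable (fun q : γ × α => F q.1 q.2) := measurable_from_prod_countable_right hF
  exact this.comp (hi.prodMk measurable_id)

/-- The length is a countable parameter, so measurability may be checked for tuples of each fixed
length. -/
theorem measurable_list_get {Φ : ∀ n, (Fin n → Plane) × α → β} (hΦ : ∀ n, Measurable (Φ n)) :
    Measurable (fun q : List Plane × α => Φ q.1.length (q.1.get, q.2)) := by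
  have h1 := measurable_of_countable_param
    (F := fun n (q : List Plane × α) => Φ n (fun i => q.1.getD i 0, q.2))
    (i := fun q : List Plane × α => q.1.length) (measurable_list_length.comp measurable_fst)
    (fun n => by
      have h2 : Measurable (fun (q : List Plane × α) (i : Fin n) => q.1.getD i 0) :=
        measurable_pi_lambda _ fun i => (measurable_list_getD i).comp measurable_fst
      exact (hΦ n).comp (h2.prodMk measurable_snd))
  convert h1 using 4 with q
  ext1 i
  simp

theorem measurable_list_append :
    Measurable (fun q : List Plane × List Plane => q.1 ++ q.2) := by
  have hl : Measurable (fun q : List Plane × List Plane => q.1.length) :=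
    measurable_list_length.comp measurable_fst
  have hr : Measurable (fun q : List Plane × List Plane => q.2.length) :=
    measurable_list_length.comp measurable_snd
  refine measurable_list_of ?_ fun i => ?_
  · simp only [List.length_append]
    exact hl.add hr
  · have : (fun q : List Plane × List Plane => (q.1 ++ q.2).getD i 0) = fun q =>
        if i < q.1.length then q.1.getD i 0 else q.2.getD (i - q.1.length) 0 := by
      funext q
      split_ifs with h
      · exact List.getD_append _ _ _ _ h
      · exact List.getD_append_right _ _ _ _ (not_lt.1 h)
    rw [this]
    refine Measurable.ite (measurableSet_lt measurable_const hl)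
      ((measurable_list_getD i).comp measurable_fst) ?_
    exact measurable_of_countable_param (F := fun n (q : List Plane × List Plane) =>
      q.2.getD (i - n) 0) hl fun n => (measurable_list_getD _).comp measurable_snd

theorem measurable_list_singleton : Measurable (fun z : Plane => [z]) := by
  refine measurable_list_of measurable_const fun i => ?_
  cases i with
  | zero => exact measurable_id
  | succ i => simp

theorem measurable_list_eraseIdx (i : ℕ) : Measurable (fun l : List Plane => l.eraseIdx i) := by
  refine measurable_list_of ?_ fun j => ?_
  · simp only [List.length_eraseIdx]
    exact Measurable.ite (measurableSet_lt measurable_const measurable_list_length)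
      (measurable_list_length.sub measurable_const) measurable_list_length
  · have : (fun l : List Plane => (l.eraseIdx i).getD j 0) = fun l =>
        if j < i then l.getD j 0 else l.getD (j + 1) 0 := by
      funext l
      simp only [List.getD_eq_getElem?_getD, List.getElem?_eraseIdx]
      split_ifs <;> rfl
    rw [this]
    split_ifs
    · exact measurable_list_getD _
    · exact measurable_list_getD _

end Lists

/-! ### The points that cannot be inferred, and compression -/

/-- The points whose labels cannot be inferred from `l`. -/
def unknown (h : Halfspace) (l : List Plane) : Set Plane :=
  {x | ∀ r, ¬ Known h {p | p ∈ l} r x}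

theorem unknown_anti {h : Halfspace} {l l' : List Plane} (hl : l ⊆ l') :
    unknown h l' ⊆ unknown h l :=
  fun _ hx r hk => hx r (hk.mono fun _ hp => hl hp)

theorem infer_get_eq_none {h : Halfspace} {l : List Plane} {x : Plane} :
    infer l.get (fun i => h.label (l.get i)) (fun i j => h.compare (l.get i) (l.get j)) x = none ↔
      x ∈ unknown h l := by
  rw [infer_eq_none, Set.range_list_get]
  rfl

theorem measurable_label (h : Halfspace) : Measurable h.label := by
  have h1 : Measurable (fun x : Plane => inner ℝ h.normal x + h.bias) := by fun_prop
  have h2 : MeasurableSet {x : Plane | 0 ≤ inner ℝ h.normal x + h.bias} :=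
    measurableSet_le measurable_const h1
  refine measurable_to_bool ?_
  convert h2 using 1
  ext x
  simp [Halfspace.label]

theorem measurable_compare (h : Halfspace) :
    Measurable (fun q : Plane × Plane => h.compare q.1 q.2) := by
  have h1 : Measurable (fun q : Plane × Plane => inner ℝ h.normal q.1) := by fun_prop
  have h2 : Measurable (fun q : Plane × Plane => inner ℝ h.normal q.2) := by fun_prop
  have h3 := measurableSet_le h2 h1
  refine measurable_to_bool ?_
  convert h3 using 1
  ext x
  simp [Halfspace.compare]

/-- Labels and comparisons on a tuple of points. -/
noncomputable def answers (h : Halfspace) {n : ℕ} (p : Fin n → Plane) :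
    (Fin n → Bool) × (Fin n → Fin n → Bool) :=
  (fun i => h.label (p i), fun i j => h.compare (p i) (p j))

theorem measurable_answers (h : Halfspace) (n : ℕ) :
    Measurable (fun p : Fin n → Plane => answers h p) := by
  refine Measurable.prodMk ?_ ?_
  · exact measurable_pi_lambda _ fun i => (measurable_label h).comp (measurable_pi_apply i)
  · refine measurable_pi_lambda _ fun i => measurable_pi_lambda _ fun j => ?_
    have : Measurable (fun p : Fin n → Plane => (p i, p j)) :=
      (measurable_pi_apply i).prodMk (measurable_pi_apply j)
    exact (measurable_compare h).comp this

/-- For fixed oracle answers the classifier is a decision tree, hence measurable, and the answers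
are measurable functions of the points with finitely many values. -/
theorem measurableSet_unknown (h : Halfspace) :
    MeasurableSet {q : List Plane × Plane | q.2 ∈ unknown h q.1} := by
  let _ : MeasurableSpace (Option Bool) := ⊤
  have key : ∀ n, Measurable (fun q : (Fin n → Plane) × Plane =>
      infer q.1 (answers h q.1).1 (answers h q.1).2 q.2) := by
    intro n
    refine measurable_of_countable_param
      (F := fun (b : (Fin n → Bool) × (Fin n → Fin n → Bool)) (q : (Fin n → Plane) × Plane) =>
        infer q.1 b.1 b.2 q.2) ((measurable_answers h n).comp measurable_fst) fun b => ?_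
    have h1 := (isTree_infer (P := fun i (p : Option (Fin n) → Plane) => p (some i))
      (fun i => IsPolyPoint.eval (some i)) b.1 b.2 (IsPolyPoint.eval none)).measurable
    have h2 : Measurable (fun (q : (Fin n → Plane) × Plane) (o : Option (Fin n)) =>
        o.elim q.2 q.1) := by
      refine measurable_pi_lambda _ fun o => ?_
      cases o with
      | none => exact measurable_snd
      | some i => exact (measurable_pi_apply i).comp measurable_fst
    exact h1.comp h2
  have h1 := measurable_list_get key (measurableSet_singleton none)
  convert h1 using 1
  ext q
  exact infer_get_eq_none.symm

/-- Forget one point. -/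
noncomputable def forget (h : Halfspace) (l : List Plane) : List Plane :=
  l.eraseIdx (removal l.get (answers h l.get).1 (answers h l.get).2)

theorem length_forget {h : Halfspace} {l : List Plane} (hl : 0 < l.length) :
    (forget h l).length = l.length - 1 :=
  List.length_eraseIdx_of_lt (removal_lt hl _ _ _)

theorem unknown_forget {h : Halfspace} {l : List Plane} (hl : 10 < l.length) :
    unknown h (forget h l) ⊆ unknown h l := by
  intro x hx r hk
  have hex := exists_removable h l.get (by simpa using hl)
  refine hx r ?_
  rw [← Set.range_list_get] at hk
  refine (hex.choose_spec.known hk).mono ?_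
  rintro _ ⟨j, hj, rfl⟩
  -- The index that `forget` erases is the very witness chosen in `removal`, so its removability
  -- applies.
  have e : forget h l = l.eraseIdx (hex.choose : Fin l.length) := by
    unfold forget removal answers
    rw [dif_pos hex]
  rw [e]
  refine List.mem_eraseIdx_iff_getElem.2 ⟨j, j.is_lt, fun e => hj (Fin.ext e), rfl⟩

theorem measurable_forget (h : Halfspace) : Measurable (forget h) := by
  have key : ∀ n, Measurable (fun q : (Fin n → Plane) × Unit =>
      removal q.1 (answers h q.1).1 (answers h q.1).2) := by
    intro n
    refine measurable_of_countable_param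
      (F := fun (b : (Fin n → Bool) × (Fin n → Fin n → Bool)) (q : (Fin n → Plane) × Unit) =>
        removal q.1 b.1 b.2) ((measurable_answers h n).comp measurable_fst) fun b => ?_
    exact (isTree_removal b.1 b.2).measurable.comp measurable_fst
  have h1 := (measurable_list_get key).comp
    (measurable_id.prodMk (measurable_const (a := ())) :
      Measurable (fun l : List Plane => (l, ())))
  exact measurable_of_countable_param (F := fun i (l : List Plane) => l.eraseIdx i) h1
    measurable_list_eraseIdx

/-- Forget points until at most ten remain. -/
noncomputable def compress (h : Halfspace) (l : List Plane) : List Plane :=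
  (forget h)^[l.length - 10] l

theorem compress_of_le {h : Halfspace} {l : List Plane} (hl : l.length ≤ 10) :
    compress h l = l := by
  simp [compress, Nat.sub_eq_zero_of_le hl]

theorem compress_of_lt {h : Halfspace} {l : List Plane} (hl : 10 < l.length) :
    compress h l = compress h (forget h l) := by
  unfold compress
  rw [length_forget (by omega)]
  obtain ⟨k, hk⟩ : ∃ k, l.length - 10 = k + 1 := ⟨l.length - 11, by omega⟩
  rw [hk, Function.iterate_succ_apply]
  congr 1
  omega

theorem length_compress (h : Halfspace) (l : List Plane) : (compress h l).length ≤ 10 := by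
  induction hn : l.length generalizing l with
  | zero => rw [compress_of_le (by omega)]; omega
  | succ n ih =>
    by_cases hl : l.length ≤ 10
    · rwa [compress_of_le hl]
    · rw [compress_of_lt (by omega)]
      exact ih _ (by rw [length_forget] <;> omega)

theorem unknown_compress (h : Halfspace) (l : List Plane) :
    unknown h (compress h l) ⊆ unknown h l := by
  induction hn : l.length generalizing l with
  | zero => rw [compress_of_le (by omega)]
  | succ n ih =>
    by_cases hl : l.length ≤ 10
    · rw [compress_of_le hl]
    · rw [compress_of_lt (by omega)]
      exact (ih _ (by rw [length_forget] <;> omega)).trans (unknown_forget (by omega))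

theorem measurable_compress (h : Halfspace) : Measurable (compress h) :=
  measurable_of_countable_param (F := fun n (l : List Plane) => (forget h)^[n - 10] l)
    measurable_list_length fun n => (measurable_forget h).iterate (n - 10)

/-! ### The process of stored points -/

open Classical in
/-- Store `z` if it cannot be inferred from `σ` and fewer than 19 points have been stored. -/
noncomputable def collectOne (h : Halfspace) (σ y : List Plane) (z : Plane) : List Plane :=
  if z ∈ unknown h σ ∧ y.length < 19 then y ++ [z] else y

/-- Process `k` points of the stream. -/
noncomputable def collect (h : Halfspace) (σ : List Plane) :
    ℕ → List Plane → (ℕ → Plane) → List Plane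
  | 0, y, _ => y
  | k + 1, y, ω => collect h σ k (collectOne h σ y (ω 0)) (fun i => ω (i + 1))

/-- Run a number of phases, each of which processes `B` points of the stream. -/
noncomputable def phases (h : Halfspace) (B : ℕ) : ℕ → List Plane → (ℕ → Plane) → List Plane
  | 0, σ, _ => σ
  | t + 1, σ, ω => phases h B t (compress h (σ ++ collect h σ B [] ω)) (fun i => ω (B + i))

/-- The final result when `k` points of the present phase and `t` later phases remain. -/
noncomputable def runFrom (h : Halfspace) (B t k : ℕ) (σ y : List Plane) (ω : ℕ → Plane) :
    List Plane :=
  phases h B t (compress h (σ ++ collect h σ k y ω)) (fun i => ω (k + i))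

theorem runFrom_succ (h : Halfspace) (B t k : ℕ) (σ y : List Plane) (ω : ℕ → Plane) :
    runFrom h B t (k + 1) σ y ω =
      runFrom h B t k σ (collectOne h σ y (ω 0)) (fun i => ω (i + 1)) := by
  unfold runFrom
  rw [collect]
  congr 1
  funext i
  congr 1
  omega

theorem runFrom_zero_succ (h : Halfspace) (B t : ℕ) (σ y : List Plane) (ω : ℕ → Plane) :
    runFrom h B (t + 1) 0 σ y ω = runFrom h B t B (compress h (σ ++ y)) [] ω := by
  simp [runFrom, collect, phases]

theorem runFrom_zero_zero (h : Halfspace) (B : ℕ) (σ y : List Plane) (ω : ℕ → Plane) :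
    runFrom h B 0 0 σ y ω = compress h (σ ++ y) := rfl

theorem length_collectOne {h : Halfspace} {σ y : List Plane} {z : Plane} (hy : y.length ≤ 19) :
    (collectOne h σ y z).length ≤ 19 := by
  unfold collectOne
  split_ifs with hc
  · simp; omega
  · exact hy

theorem measurable_collectOne (h : Halfspace) :
    Measurable (fun q : (List Plane × List Plane) × Plane => collectOne h q.1.1 q.1.2 q.2) := by
  unfold collectOne
  refine Measurable.ite ?_ ?_ measurable_fst.snd
  · refine MeasurableSet.inter ?_ ?_
    · exact (measurableSet_unknown h).preimage (measurable_fst.fst.prodMk measurable_snd)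
    · exact measurableSet_lt (measurable_list_length.comp measurable_fst.snd) measurable_const
  · exact measurable_list_append.comp
      (measurable_fst.snd.prodMk (measurable_list_singleton.comp measurable_snd))

theorem measurable_collect (h : Halfspace) (k : ℕ) :
    Measurable (fun q : (List Plane × List Plane) × (ℕ → Plane) =>
      collect h q.1.1 k q.1.2 q.2) := by
  induction k with
  | zero => exact measurable_fst.snd
  | succ k ih =>
    have h0 : Measurable (fun q : (List Plane × List Plane) × (ℕ → Plane) => q.2 0) :=
      (measurable_pi_apply 0).comp measurable_snd
    have h1 : Measurable (fun (q : (List Plane × List Plane) × (ℕ → Plane)) (i : ℕ) =>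
        q.2 (i + 1)) :=
      measurable_pi_lambda _ fun i => (measurable_pi_apply (i + 1)).comp measurable_snd
    exact ih.comp ((measurable_fst.fst.prodMk
      ((measurable_collectOne h).comp (measurable_fst.prodMk h0))).prodMk h1)

theorem measurable_phases (h : Halfspace) (B t : ℕ) :
    Measurable (fun q : List Plane × (ℕ → Plane) => phases h B t q.1 q.2) := by
  induction t with
  | zero => exact measurable_fst
  | succ t ih =>
    have h1 : Measurable (fun (q : List Plane × (ℕ → Plane)) (i : ℕ) => q.2 (B + i)) :=
      measurable_pi_lambda _ fun i => (measurable_pi_apply (B + i)).comp measurable_snd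
    have h2 : Measurable (fun q : List Plane × (ℕ → Plane) => collect h q.1 B [] q.2) :=
      (measurable_collect h B).comp ((measurable_fst.prodMk measurable_const).prodMk measurable_snd)
    exact ih.comp (((measurable_compress h).comp
      (measurable_list_append.comp (measurable_fst.prodMk h2))).prodMk h1)

theorem measurable_runFrom (h : Halfspace) (B t k : ℕ) (σ y : List Plane) :
    Measurable (fun ω => runFrom h B t k σ y ω) := by
  have h1 : Measurable (fun (ω : ℕ → Plane) (i : ℕ) => ω (k + i)) :=
    measurable_pi_lambda _ fun i => measurable_pi_apply (k + i)
  have h2 : Measurable (fun ω : ℕ → Plane => collect h σ k y ω) :=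
    (measurable_collect h k).comp ((measurable_const (a := (σ, y))).prodMk measurable_id)
  exact (measurable_phases h B t).comp (((measurable_compress h).comp
    (measurable_list_append.comp (measurable_const.prodMk h2))).prodMk h1)


/-! ### Streams of independent points -/

/-- Put a point in front of a stream. -/
def consStream (z : Plane) (ω : ℕ → Plane) : ℕ → Plane
  | 0 => z
  | n + 1 => ω n

theorem measurable_consStream :
    Measurable (fun q : Plane × (ℕ → Plane) => consStream q.1 q.2) := by
  refine measurable_pi_lambda _ fun i => ?_
  cases i with
  | zero => exact measurable_fst
  | succ i => exact (measurable_pi_apply i).comp measurable_snd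

section Stream

variable (D : Measure Plane) [IsProbabilityMeasure D]

/-- The law of a stream of independent points. -/
noncomputable abbrev streamLaw : Measure (ℕ → Plane) := Measure.infinitePi (fun _ : ℕ => D)

/-- An infinite product measure is determined by cylinders; prepending a coordinate splits off the
condition at index zero and shifts the others. -/
theorem map_consStream :
    (D.prod (streamLaw D)).map (fun q => consStream q.1 q.2) = streamLaw D := by
  refine Measure.eq_infinitePi _ fun s t ht => ?_
  classical
  rw [Measure.map_apply measurable_consStream
    (MeasurableSet.pi s.countable_toSet fun i _ => ht i)]
  set s' : Finset ℕ := (s.erase 0).image Nat.pred with hs'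
  have hmem : ∀ i, i ∈ s' ↔ i + 1 ∈ s := by
    intro i
    simp only [hs', Finset.mem_image, Finset.mem_erase]
    constructor
    · rintro ⟨j, ⟨hj0, hj⟩, rfl⟩
      rwa [← Nat.succ_eq_add_one, Nat.succ_pred hj0]
    · intro hi
      exact ⟨i + 1, ⟨by omega, hi⟩, rfl⟩
  have hpre : (fun q : Plane × (ℕ → Plane) => consStream q.1 q.2) ⁻¹' (Set.pi s t) =
      (if 0 ∈ s then t 0 else Set.univ) ×ˢ (Set.pi s' (fun i => t (i + 1))) := by
    ext ⟨z, ω⟩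
    simp only [Set.mem_preimage, Set.mem_pi, Set.mem_prod, Finset.mem_coe]
    constructor
    · intro H
      refine ⟨?_, fun i hi => H (i + 1) ((hmem i).1 hi)⟩
      split_ifs with h0
      · exact H 0 h0
      · trivial
    · rintro ⟨H0, H⟩ i hi
      cases i with
      | zero => rw [if_pos hi] at H0; exact H0
      | succ i => exact H i ((hmem i).2 hi)
  rw [hpre, Measure.prod_prod, Measure.infinitePi_pi _ (fun i _ => ht (i + 1))]
  have hprod : ∏ i ∈ s', D (t (i + 1)) = ∏ i ∈ s.erase 0, D (t i) := by
    refine Finset.prod_bij (fun i _ => i + 1) ?_ ?_ ?_ ?_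
    · intro i hi; simpa using (hmem i).1 hi
    · intro i _ j _ hij; omega
    · intro j hj
      rw [Finset.mem_erase] at hj
      refine ⟨j - 1, (hmem _).2 ?_, ?_⟩
      · rw [Nat.sub_add_cancel (Nat.one_le_iff_ne_zero.2 hj.1)]; exact hj.2
      · exact Nat.sub_add_cancel (Nat.one_le_iff_ne_zero.2 hj.1)
    · intros; rfl
  rw [hprod]
  split_ifs with h0
  · rw [Finset.mul_prod_erase s (fun i => D (t i)) h0]
  · rw [measure_univ, one_mul, Finset.erase_eq_of_notMem h0]

/-- First-step decomposition of an integral over streams. -/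
theorem lintegral_consStream {F : (ℕ → Plane) → ENNReal} (hF : Measurable F) :
    ∫⁻ ω, F ω ∂(streamLaw D) = ∫⁻ z, ∫⁻ ω, F (consStream z ω) ∂(streamLaw D) ∂D := by
  conv_lhs => rw [← map_consStream D]
  rw [lintegral_map hF measurable_consStream,
    lintegral_prod (fun q : Plane × (ℕ → Plane) => F (consStream q.1 q.2))
      (hF.comp measurable_consStream).aemeasurable]

theorem measure_consStream {S : Set (ℕ → Plane)} (hS : MeasurableSet S) :
    streamLaw D S = ∫⁻ z, streamLaw D {ω | consStream z ω ∈ S} ∂D := by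
  conv_lhs => rw [← map_consStream D]
  rw [Measure.map_apply measurable_consStream hS,
    Measure.prod_apply (measurable_consStream hS)]
  rfl

/-! ### Exchangeability -/

/-- The expected mass of the points that cannot be inferred when `j` more points are drawn. -/
noncomputable def expectedUnknown (h : Halfspace) : ℕ → List Plane → ENNReal
  | 0, y => D (unknown h y)
  | j + 1, y => ∫⁻ z, expectedUnknown h j (y ++ [z]) ∂D

/-- The next point of the stream cannot be inferred from `y` and the first `j` points. -/
def nextUnknown (h : Halfspace) (j : ℕ) (y : List Plane) : Set (ℕ → Plane) :=
  {ω | ω j ∈ unknown h (y ++ List.ofFn (fun i : Fin j => ω i))}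

theorem measurable_list_ofFn (j : ℕ) :
    Measurable (fun ω : ℕ → Plane => List.ofFn (fun i : Fin j => ω i)) := by
  refine measurable_list_of (by simp) fun i => ?_
  by_cases hi : i < j
  · simpa [List.getD_eq_getElem?_getD, hi] using measurable_pi_apply i
  · simp [List.getD_eq_getElem?_getD, hi]

theorem measurableSet_nextUnknown (h : Halfspace) (j : ℕ) (y : List Plane) :
    MeasurableSet (nextUnknown h j y) :=
  (measurableSet_unknown h).preimage ((measurable_list_append.comp
    (measurable_const.prodMk (measurable_list_ofFn j))).prodMk (measurable_pi_apply j))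

/-- The expected mass of a random set is the probability that one further independent point falls in
it. This turns the recursion into an event on streams, to which exchangeability applies. -/
theorem expectedUnknown_eq (h : Halfspace) (j : ℕ) (y : List Plane) :
    expectedUnknown D h j y = streamLaw D (nextUnknown h j y) := by
  induction j generalizing y with
  | zero =>
    have hU : MeasurableSet (unknown h y) :=
      (measurableSet_unknown h).preimage (measurable_const.prodMk measurable_id)
    have h1 := (measurePreserving_eval_infinitePi (fun _ : ℕ => D) 0).measure_preimage
      hU.nullMeasurableSet
    rw [expectedUnknown, ← h1]
    simp [nextUnknown, Set.preimage, Function.eval]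
  | succ j ih =>
    rw [expectedUnknown, measure_consStream D (measurableSet_nextUnknown h _ _)]
    refine lintegral_congr fun z => ?_
    rw [ih]
    congr 1
    ext ω
    simp [nextUnknown, consStream, List.ofFn_succ]

theorem measurePreserving_swap (i j : ℕ) :
    MeasurePreserving (fun (ω : ℕ → Plane) k => ω (Equiv.swap i j k))
      (streamLaw D) (streamLaw D) := by
  refine ⟨measurable_pi_lambda _ fun k => measurable_pi_apply _, ?_⟩
  have h1 := Measure.infinitePi_map_piCongrLeft (fun _ : ℕ => D) (Equiv.swap i j)
  convert h1 using 2
  ext1 ω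
  funext k
  have h2 := MeasurableEquiv.piCongrLeft_apply_apply (β := fun _ : ℕ => Plane) (Equiv.swap i j) ω
    (Equiv.swap i j k)
  rw [Equiv.swap_apply_self] at h2
  exact h2.symm

/-- Swapping coordinates `i` and `m` preserves the law, so each of the first `m + 1` points has the
same probability of not being inferable from the other `m`. On every stream at most ten of these
events occur, by `card_unknown_le`. -/
theorem expectedUnknown_nil_le (h : Halfspace) (m : ℕ) :
    (m + 1 : ℕ) * expectedUnknown D h m [] ≤ 10 := by
  classical
  rw [expectedUnknown_eq]
  set A : Fin (m + 1) → Set (ℕ → Plane) := fun i =>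
    (fun (ω : ℕ → Plane) k => ω (Equiv.swap (i : ℕ) m k)) ⁻¹' nextUnknown h m [] with hA
  have hAm : ∀ i, MeasurableSet (A i) := fun i =>
    (measurePreserving_swap D i m).measurable (measurableSet_nextUnknown h m [])
  have hAe : ∀ i, streamLaw D (A i) = streamLaw D (nextUnknown h m []) := fun i =>
    (measurePreserving_swap D i m).measure_preimage
      (measurableSet_nextUnknown h m []).nullMeasurableSet
  have hsub : ∀ i ω, ω ∈ A i → ∀ r, ¬ Known h ((fun k : Fin (m + 1) => ω k) '' {i}ᶜ) r (ω i) := by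
    intro i ω hω r hk
    have h1 : Equiv.swap (i : ℕ) m m = i := Equiv.swap_apply_right _ _
    have h2 := hω r
    simp only [h1] at h2
    refine h2 (hk.mono ?_)
    rintro _ ⟨k, hk, rfl⟩
    have hki : (k : ℕ) ≠ i := fun e => hk (Fin.ext e)
    simp only [List.nil_append, Set.mem_ofPred_eq, List.mem_ofFn]
    by_cases hkm : (k : ℕ) = m
    · have him : (i : ℕ) < m := by have := i.is_lt; omega
      exact ⟨⟨i, him⟩, by simp [hkm]⟩
    · have : (k : ℕ) < m := by have := k.is_lt; omega
      exact ⟨⟨k, this⟩, by simp [Equiv.swap_apply_of_ne_of_ne hki hkm]⟩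
  calc ((m + 1 : ℕ) : ENNReal) * streamLaw D (nextUnknown h m [])
      = ∑ i : Fin (m + 1), streamLaw D (A i) := by
        simp [hAe]
    _ = ∑ i : Fin (m + 1), ∫⁻ ω, (A i).indicator 1 ω ∂(streamLaw D) := by
        simp only [lintegral_indicator_one (hAm _)]
    _ = ∫⁻ ω, ∑ i : Fin (m + 1), (A i).indicator 1 ω ∂(streamLaw D) := by
        rw [lintegral_finsetSum]
        exact fun i _ => measurable_one.indicator (hAm i)
    _ ≤ ∫⁻ ω, 10 ∂(streamLaw D) := by
        refine lintegral_mono fun ω => ?_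
        have h1 : ∑ i : Fin (m + 1), (A i).indicator (1 : (ℕ → Plane) → ENNReal) ω =
            ((Finset.univ.filter (fun i => ω ∈ A i)).card : ENNReal) := by
          simp [Set.indicator_apply]
        rw [h1]
        have h2 := card_unknown_le h (fun k : Fin (m + 1) => ω k)
        have h3 : (Finset.univ.filter (fun i => ω ∈ A i)).card ≤ 10 := by
          refine (Finset.card_le_card fun i hi => ?_).trans h2
          simp only [Finset.mem_filter, Finset.mem_univ, true_and] at hi ⊢
          exact hsub i ω hi
        calc _ ≤ ((10 : ℕ) : ENNReal) := Nat.cast_le.2 h3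
          _ = 10 := by norm_num
    _ = 10 := by simp

end Stream

/-! ### One phase -/

/-- The probability that fewer than `j` out of `k` independent trials succeed. -/
noncomputable def tail (p q : ENNReal) : ℕ → ℕ → ENNReal
  | _, 0 => 0
  | 0, _ + 1 => 1
  | k + 1, j + 1 => p * tail p q k j + q * tail p q k (j + 1)

theorem tail_succ_succ (p q : ENNReal) (k j : ℕ) :
    tail p q (k + 1) (j + 1) = p * tail p q k j + q * tail p q k (j + 1) := by
  rw [tail]

/-- This is an exponential Markov bound: for the number `X` of successes, `2 ^ (-X)` has mean `(1 -
p / 2) ^ k`. In the recursion the bound has slack `(p / 2) * (1 - p / 2) ^ k`. -/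
theorem tail_le {p : ℝ} (hp0 : 0 ≤ p) (hp1 : p ≤ 1) (k j : ℕ) :
    tail (ENNReal.ofReal p) (ENNReal.ofReal (1 - p)) k j ≤
      ENNReal.ofReal ((2 ^ j - 1) * (1 - p / 2) ^ k) := by
  induction k generalizing j with
  | zero =>
    cases j with
    | zero => simp [tail]
    | succ j =>
      rw [tail, ENNReal.one_le_ofReal, pow_zero, mul_one, pow_succ]
      have : (1 : ℝ) ≤ 2 ^ j := one_le_pow₀ (by norm_num)
      linarith
  | succ k ih =>
    cases j with
    | zero => simp [tail]
    | succ j =>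
      have hr : 0 ≤ 1 - p / 2 := by linarith
      have h1 : (1 : ℝ) ≤ 2 ^ j := one_le_pow₀ (by norm_num)
      have h2 : (1 : ℝ) ≤ 2 ^ (j + 1) := one_le_pow₀ (by norm_num)
      have h3 : 0 ≤ (1 - p / 2) ^ k := pow_nonneg hr k
      rw [tail]
      calc _ ≤ ENNReal.ofReal p * ENNReal.ofReal ((2 ^ j - 1) * (1 - p / 2) ^ k) +
            ENNReal.ofReal (1 - p) * ENNReal.ofReal ((2 ^ (j + 1) - 1) * (1 - p / 2) ^ k) := by
            gcongr
            · exact ih j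
            · exact ih (j + 1)
        _ = ENNReal.ofReal (p * ((2 ^ j - 1) * (1 - p / 2) ^ k) +
            (1 - p) * ((2 ^ (j + 1) - 1) * (1 - p / 2) ^ k)) := by
            have h4 : 0 ≤ 1 - p := by linarith
            rw [ENNReal.ofReal_add (mul_nonneg hp0 (mul_nonneg (by linarith) h3))
              (mul_nonneg h4 (mul_nonneg (by linarith) h3)), ENNReal.ofReal_mul hp0,
              ENNReal.ofReal_mul h4]
        _ ≤ _ := by
            apply ENNReal.ofReal_le_ofReal
            have : (2 ^ (j + 1) - 1 : ℝ) * (1 - p / 2) ^ (k + 1) -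
                (p * ((2 ^ j - 1) * (1 - p / 2) ^ k) +
                  (1 - p) * ((2 ^ (j + 1) - 1) * (1 - p / 2) ^ k)) =
                (p / 2) * (1 - p / 2) ^ k := by
              ring
            nlinarith [mul_nonneg (by linarith : 0 ≤ p / 2) h3]

section Phase

variable (D : Measure Plane) [IsProbabilityMeasure D] (h : Halfspace)

theorem measurableSet_unknown_right (l : List Plane) : MeasurableSet (unknown h l) :=
  (measurableSet_unknown h).preimage (measurable_const.prodMk measurable_id)

/-- The mass of the points that cannot be inferred, when it exceeds `e`. -/
noncomputable def excess (e : ENNReal) (σ : List Plane) : ENNReal :=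
  if D (unknown h σ) ≤ e then 0 else D (unknown h σ)

/-- A bound for the expected excess at the end of a phase, when `k` points of the phase remain. -/
noncomputable def phaseBound (e : ENNReal) (k : ℕ) (σ y : List Plane) : ENNReal :=
  if D (unknown h σ) ≤ e then 0 else
    D (unknown h σ) * (expectedUnknown (ProbabilityTheory.cond D (unknown h σ)) h (19 - y.length) y +
      tail (D (unknown h σ)) (D (unknown h σ)ᶜ) k (19 - y.length))

/-- If 19 points were kept, what remains unknown lies in `unknown h σ ∩ unknown h y`, whose mass is
the first term of the bound. Otherwise the tail equals `1`, and it suffices that the unknown set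
never grows. -/
theorem excess_compress_le (e : ENNReal) (σ y : List Plane) :
    excess D h e (compress h (σ ++ y)) ≤ phaseBound D h e 0 σ y := by
  have h1 : unknown h (compress h (σ ++ y)) ⊆ unknown h σ ∩ unknown h y :=
    (unknown_compress h _).trans (Set.subset_inter
      (unknown_anti (List.subset_append_left σ y)) (unknown_anti (List.subset_append_right σ y)))
  have h2 : D (unknown h (compress h (σ ++ y))) ≤ D (unknown h σ) :=
    measure_mono (h1.trans Set.inter_subset_left)
  unfold excess phaseBound
  split_ifs with h3 h4 h4
  · exact le_rfl
  · exact zero_le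
  · exact absurd (h2.trans h4) h3
  · have hp0 : D (unknown h σ) ≠ 0 := fun h0 => h4 (h0 ▸ zero_le)
    rcases hj : 19 - y.length with _ | j
    · rw [expectedUnknown, ProbabilityTheory.cond_apply (measurableSet_unknown_right h σ), tail,
        add_zero, ← mul_assoc, ENNReal.mul_inv_cancel hp0 (measure_ne_top D _), one_mul]
      exact measure_mono h1
    · rw [tail]
      calc _ ≤ D (unknown h σ) * 1 := by rw [mul_one]; exact h2
        _ ≤ _ := by gcongr; exact le_add_self

/-- The bound is a supermartingale within a phase. With probability `D U` the new point falls in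
`U`; its conditional law is then `ν`, which is one step of `expectedUnknown`. Otherwise nothing is
stored, and the tail follows its recursion. -/
theorem lintegral_phaseBound_le (e : ENNReal) (k : ℕ) (σ y : List Plane) :
    ∫⁻ z, phaseBound D h e k σ (collectOne h σ y z) ∂D ≤ phaseBound D h e (k + 1) σ y := by
  by_cases h4 : D (unknown h σ) ≤ e
  · simp [phaseBound, h4]
  have hp0 : D (unknown h σ) ≠ 0 := fun h0 => h4 (h0 ▸ zero_le)
  have hpt : D (unknown h σ) ≠ ⊤ := measure_ne_top D _
  rcases hj : 19 - y.length with _ | j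
  · have h5 : ¬ y.length < 19 := by omega
    simp [collectOne, h5, phaseBound, h4, hj, tail]
  · have h5 : y.length < 19 := by omega
    have h6 : 19 - (y.length + 1) = j := by omega
    have hU := measurableSet_unknown_right h σ
    simp only [phaseBound, if_neg h4]
    rw [lintegral_const_mul' _ _ hpt]
    gcongr
    set U := unknown h σ with hUdef
    set ν := ProbabilityTheory.cond D U with hν
    rw [← lintegral_add_compl _ hU]
    have e1 : ∫⁻ z in U, (expectedUnknown ν h (19 - (collectOne h σ y z).length)
          (collectOne h σ y z) +
          tail (D U) (D Uᶜ) k (19 - (collectOne h σ y z).length)) ∂D =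
        D U * expectedUnknown ν h (j + 1) y + D U * tail (D U) (D Uᶜ) k j := by
      have : ∫⁻ z in U, (expectedUnknown ν h (19 - (collectOne h σ y z).length)
          (collectOne h σ y z) +
          tail (D U) (D Uᶜ) k (19 - (collectOne h σ y z).length)) ∂D =
          ∫⁻ z in U, (expectedUnknown ν h j (y ++ [z]) + tail (D U) (D Uᶜ) k j) ∂D := by
        refine setLIntegral_congr_fun hU fun z hz => ?_
        have : collectOne h σ y z = y ++ [z] := by
          unfold collectOne; rw [if_pos ⟨hz, h5⟩]
        simp only [this, List.length_append, List.length_singleton, h6]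
      rw [this, lintegral_add_right _ measurable_const, setLIntegral_const,
        mul_comm (tail _ _ _ _), expectedUnknown]
      congr 1
      rw [hν, ProbabilityTheory.cond, lintegral_smul_measure, smul_eq_mul, ← mul_assoc,
        ENNReal.mul_inv_cancel hp0 hpt, one_mul]
    have e2 : ∫⁻ z in Uᶜ, (expectedUnknown ν h (19 - (collectOne h σ y z).length)
          (collectOne h σ y z) +
          tail (D U) (D Uᶜ) k (19 - (collectOne h σ y z).length)) ∂D =
        D Uᶜ * expectedUnknown ν h (j + 1) y + D Uᶜ * tail (D U) (D Uᶜ) k (j + 1) := by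
      have : ∫⁻ z in Uᶜ, (expectedUnknown ν h (19 - (collectOne h σ y z).length)
          (collectOne h σ y z) +
          tail (D U) (D Uᶜ) k (19 - (collectOne h σ y z).length)) ∂D =
          ∫⁻ z in Uᶜ, (expectedUnknown ν h (j + 1) y + tail (D U) (D Uᶜ) k (j + 1)) ∂D := by
        refine setLIntegral_congr_fun hU.compl fun z hz => ?_
        have : collectOne h σ y z = y := by
          unfold collectOne; rw [if_neg (fun hc => hz hc.1)]
        simp only [this, hj]
      rw [this, setLIntegral_const, mul_comm, mul_add]
    rw [e1, e2, hj, tail_succ_succ]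
    have e3 : D U + D Uᶜ = 1 := by rw [measure_add_measure_compl hU, measure_univ]
    calc _ = (D U + D Uᶜ) * expectedUnknown ν h (j + 1) y +
          (D U * tail (D U) (D Uᶜ) k j + D Uᶜ * tail (D U) (D Uᶜ) k (j + 1)) := by ring
      _ ≤ _ := by rw [e3, one_mul]

/-- Over a complete phase, the expected excess decreases by a constant factor. -/
theorem phaseBound_nil_le {ε : ℝ} (hε : 0 < ε) {B : ℕ} (hB : 32 / ε ≤ B) (σ : List Plane) :
    phaseBound D h (ENNReal.ofReal ε) B σ [] ≤ ENNReal.ofReal (3 / 4) *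
      excess D h (ENNReal.ofReal ε) σ := by
  unfold phaseBound excess
  split_ifs with h4
  · simp
  have hp0 : D (unknown h σ) ≠ 0 := fun h0 => h4 (h0 ▸ zero_le)
  have hpt : D (unknown h σ) ≠ ⊤ := measure_ne_top D _
  have : IsProbabilityMeasure (ProbabilityTheory.cond D (unknown h σ)) :=
    ProbabilityTheory.cond_isProbabilityMeasure hp0
  rw [mul_comm (ENNReal.ofReal (3 / 4))]
  gcongr
  have e1 : expectedUnknown (ProbabilityTheory.cond D (unknown h σ)) h 19 [] ≤
      ENNReal.ofReal (1 / 2) := by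
    -- With 19 points drawn the bound is `10 / 20`; this is the reason for keeping 19 points.
    have h1 := expectedUnknown_nil_le (ProbabilityTheory.cond D (unknown h σ)) h 19
    set x := expectedUnknown (ProbabilityTheory.cond D (unknown h σ)) h 19 []
    have hx : x ≠ ⊤ := by
      rintro hx
      rw [hx] at h1
      norm_num at h1
    rw [← ENNReal.ofReal_toReal hx] at h1 ⊢
    apply ENNReal.ofReal_le_ofReal
    have h2 : (20 : ℝ) * x.toReal ≤ 10 := by
      have h3 : ENNReal.ofReal (20 * x.toReal) ≤ ENNReal.ofReal 10 := by
        rw [ENNReal.ofReal_mul (by norm_num)]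
        convert h1 using 1
        · norm_num
        · norm_num
      exact (ENNReal.ofReal_le_ofReal_iff (by norm_num)).1 h3
    linarith
  have e2 : tail (D (unknown h σ)) (D (unknown h σ)ᶜ) B 19 ≤ ENNReal.ofReal (1 / 4) := by
    set p := (D (unknown h σ)).toReal with hp
    have hpD : D (unknown h σ) = ENNReal.ofReal p := (ENNReal.ofReal_toReal hpt).symm
    have hp_nonneg : 0 ≤ p := ENNReal.toReal_nonneg
    have hp1 : p ≤ 1 := by
      rw [hp]
      exact ENNReal.toReal_le_of_le_ofReal (by norm_num) (by simpa using prob_le_one)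
    have hεp : ε ≤ p := by
      rw [hpD] at h4
      by_contra hcon
      exact h4 (ENNReal.ofReal_le_ofReal (not_le.1 hcon).le)
    have hcompl : D (unknown h σ)ᶜ = ENNReal.ofReal (1 - p) := by
      rw [prob_compl_eq_one_sub (measurableSet_unknown_right h σ), hpD,
        ENNReal.ofReal_sub _ hp_nonneg, ENNReal.ofReal_one]
    rw [hcompl, hpD]
    refine (tail_le hp_nonneg hp1 B 19).trans (ENNReal.ofReal_le_ofReal ?_)
    -- From `B ≥ 32 / ε` and `p ≥ ε` the exponent `B * p / 2` is at least 16, and `exp (-16)`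
    -- outweighs the factor `2 ^ 19`.
    have h5 : (1 - p / 2) ^ B ≤ Real.exp (-16) := by
      calc (1 - p / 2) ^ B ≤ (Real.exp (-(p / 2))) ^ B := by
            apply pow_le_pow_left₀ (by linarith)
            have := Real.add_one_le_exp (-(p / 2))
            linarith
        _ = Real.exp (B * -(p / 2)) := by rw [← Real.exp_nat_mul]
        _ ≤ Real.exp (-16) := by
            apply Real.exp_le_exp.2
            have h6 : 32 ≤ B * ε := by rwa [div_le_iff₀ hε] at hB
            have h7 : (B : ℝ) * ε ≤ B * p := by gcongr
            linarith
    have h8 : Real.exp (-16) ≤ (2.7 ^ 16)⁻¹ := by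
      rw [Real.exp_neg]
      apply inv_anti₀ (by positivity)
      have h9 : (2.7 : ℝ) ≤ Real.exp 1 := by have := Real.exp_one_gt_d9; linarith
      calc (2.7 : ℝ) ^ 16 ≤ (Real.exp 1) ^ 16 := pow_le_pow_left₀ (by norm_num) h9 16
        _ = Real.exp 16 := by rw [← Real.exp_nat_mul]; norm_num
    calc (2 ^ 19 - 1 : ℝ) * (1 - p / 2) ^ B ≤ (2 ^ 19 - 1) * (2.7 ^ 16)⁻¹ := by
          exact mul_le_mul_of_nonneg_left (h5.trans h8) (by norm_num)
      _ ≤ 1 / 4 := by norm_num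
  calc _ ≤ ENNReal.ofReal (1 / 2) + ENNReal.ofReal (1 / 4) := add_le_add e1 e2
    _ = ENNReal.ofReal (3 / 4) := by
        rw [← ENNReal.ofReal_add (by norm_num) (by norm_num)]; norm_num

theorem measurable_excess (e : ENNReal) : Measurable (excess D h e) := by
  have h1 : Measurable (fun l => D (unknown h l)) :=
    measurable_measure_prodMk_left (measurableSet_unknown h)
  exact Measurable.ite (measurableSet_le h1 measurable_const) measurable_const h1

/-- The outer induction runs over phases and the inner one over the samples left in the present
phase. Each sample is integrated out by the supermartingale property, and each new phase gains the
factor `3 / 4`. -/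
theorem lintegral_runFrom_le {ε : ℝ} (hε : 0 < ε) {B : ℕ} (hB : 32 / ε ≤ B) (t k : ℕ)
    (σ y : List Plane) :
    ∫⁻ ω, excess D h (ENNReal.ofReal ε) (runFrom h B t k σ y ω) ∂(streamLaw D) ≤
      ENNReal.ofReal (3 / 4) ^ t * phaseBound D h (ENNReal.ofReal ε) k σ y := by
  induction t generalizing k σ y with
  | zero =>
    induction k generalizing y with
    | zero =>
      simp only [runFrom_zero_zero, lintegral_const, measure_univ, mul_one, pow_zero, one_mul]
      exact excess_compress_le D h _ σ y
    | succ k ih =>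
      rw [lintegral_consStream D (F := fun ω => excess D h _ (runFrom h B _ (k + 1) σ y ω))
        ((measurable_excess D h _).comp (measurable_runFrom h B _ _ σ y))]
      simp only [runFrom_succ]
      refine (lintegral_mono fun z => ih _).trans ?_
      rw [lintegral_const_mul' _ _ (by simp)]
      gcongr
      exact lintegral_phaseBound_le D h _ k σ y
  | succ t iht =>
    induction k generalizing y with
    | zero =>
      simp only [runFrom_zero_succ]
      refine (iht B (compress h (σ ++ y)) []).trans ?_
      rw [pow_succ, mul_assoc]
      gcongr
      refine (phaseBound_nil_le D h hε hB _).trans ?_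
      gcongr
      exact excess_compress_le D h _ σ y
    | succ k ih =>
      rw [lintegral_consStream D (F := fun ω => excess D h _ (runFrom h B _ (k + 1) σ y ω))
        ((measurable_excess D h _).comp (measurable_runFrom h B _ _ σ y))]
      simp only [runFrom_succ]
      refine (lintegral_mono fun z => ih _).trans ?_
      rw [lintegral_const_mul' _ _ (by finiteness)]
      gcongr
      exact lintegral_phaseBound_le D h _ k σ y

/-- After sufficiently many phases, almost all points can be inferred with high probability. -/
theorem measure_phases_lt {ε δ : ℝ} (hε : 0 < ε) (hδ : 0 < δ) {B K : ℕ} (hB : 32 / ε ≤ B)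
    (hK : (3 / 4 : ℝ) ^ (K + 1) < ε * δ) :
    streamLaw D {ω | ENNReal.ofReal ε < D (unknown h (phases h B (K + 1) [] ω))} <
      ENNReal.ofReal δ := by
  have hm : Measurable (fun ω => excess D h (ENNReal.ofReal ε) (runFrom h B K B [] [] ω)) :=
    (measurable_excess D h _).comp (measurable_runFrom h B K B [] [])
  have h1 : ∫⁻ ω, excess D h (ENNReal.ofReal ε) (runFrom h B K B [] [] ω) ∂(streamLaw D) ≤
      ENNReal.ofReal ((3 / 4) ^ (K + 1)) := by
    refine (lintegral_runFrom_le D h hε hB K B [] []).trans ?_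
    rw [ENNReal.ofReal_pow (by norm_num), pow_succ]
    gcongr
    refine (phaseBound_nil_le D h hε hB []).trans ?_
    calc _ ≤ ENNReal.ofReal (3 / 4) * 1 := by
          gcongr
          unfold excess
          split_ifs
          · exact zero_le
          · exact prob_le_one
      _ = _ := mul_one _
  have h2 : ENNReal.ofReal ε *
      streamLaw D {ω | ENNReal.ofReal ε < D (unknown h (phases h B (K + 1) [] ω))} ≤
      ENNReal.ofReal ((3 / 4) ^ (K + 1)) := by
    -- Markov's inequality: whenever the unknown mass exceeds `ε`, it equals the excess.
    refine le_trans ?_ ((mul_meas_ge_le_lintegral hm (ENNReal.ofReal ε)).trans h1)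
    gcongr
    intro hω
    -- `K + 1` phases are, by definition, one full phase with `B` samples remaining followed by `K`
    -- more.
    change ENNReal.ofReal ε < D (unknown h (runFrom h B K B [] [] _)) at hω
    unfold excess
    rw [if_neg (not_le.2 hω)]
    exact hω.le
  have h3 : ENNReal.ofReal ((3 / 4) ^ (K + 1)) < ENNReal.ofReal ε * ENNReal.ofReal δ := by
    rw [← ENNReal.ofReal_mul hε.le]
    exact (ENNReal.ofReal_lt_ofReal_iff (by positivity)).2 hK
  exact lt_of_mul_lt_mul_left' (h2.trans_lt h3)

end Phase


/-! ### The contents of the work tape -/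

/-- A work tape that holds a number in unary, followed by a list of bits. -/
def pack (c : ℕ) (bits : List Bool) : List Bool := List.replicate c true ++ false :: bits

/-- The number on a work tape. -/
def unpackNum (w : List Bool) : ℕ := (w.takeWhile id).length

/-- The bits on a work tape. -/
def unpackBits (w : List Bool) : List Bool := (w.dropWhile id).tail

theorem unpackNum_pack (c : ℕ) (bits : List Bool) : unpackNum (pack c bits) = c := by
  simp [unpackNum, pack]

theorem unpackBits_pack (c : ℕ) (bits : List Bool) : unpackBits (pack c bits) = bits := by
  simp [unpackBits, pack]

theorem length_pack (c : ℕ) (bits : List Bool) : (pack c bits).length = c + 1 + bits.length := by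
  simp [pack]; omega

theorem pack_append (c : ℕ) (bits : List Bool) (b : Bool) :
    pack c bits ++ [b] = pack c (bits ++ [b]) := by
  simp [pack]

theorem unpackNum_le (w : List Bool) : unpackNum w ≤ w.length :=
  (List.takeWhile_sublist _).length_le

theorem length_unpackBits_le (w : List Bool) : (unpackBits w).length ≤ w.length :=
  ((List.tail_sublist _).trans (List.dropWhile_sublist _)).length_le

/-- The control state: a mode and two parameters. -/
def control (a b c : ℕ) : ℕ := Nat.pair a (Nat.pair b c)

theorem control_lt {a b c X : ℕ} (ha : a ≤ X) (hb : b ≤ X) (hc : c ≤ X) :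
    control a b c < ((X + 1) ^ 2 + 1) ^ 2 := by
  have h1 : Nat.pair b c < (X + 1) ^ 2 :=
    (Nat.pair_lt_max_add_one_sq b c).trans_le (Nat.pow_le_pow_left (by omega) 2)
  refine (Nat.pair_lt_max_add_one_sq a (Nat.pair b c)).trans_le (Nat.pow_le_pow_left ?_ 2)
  have : X ≤ (X + 1) ^ 2 := by nlinarith
  omega

/-! ### Queries on all stored points -/

/-- The labels that are recorded in a list of bits. -/
def labOf (n : ℕ) (bits : List Bool) : Fin n → Bool := fun i => bits.getD i false

/-- The comparisons that are recorded in a list of bits. -/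
def cmpOf (n : ℕ) (bits : List Bool) : Fin n → Fin n → Bool :=
  fun i j => bits.getD (n + (i * n + j)) false

/-- The answer to the `j`-th query on the points in a list. -/
noncomputable def queryAnswer (h : Halfspace) (P : List Plane) (j : ℕ) : Bool :=
  if j < P.length then h.label (P.getD j 0)
  else h.compare (P.getD ((j - P.length) / P.length) 0) (P.getD ((j - P.length) % P.length) 0)

/-- The answers to all queries on the points in a list. -/
noncomputable def answerBits (h : Halfspace) (P : List Plane) : List Bool :=
  (List.range (P.length + P.length * P.length)).map (queryAnswer h P)

theorem labOf_answerBits (h : Halfspace) (P : List Plane) :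
    labOf P.length (answerBits h P) = (answers h P.get).1 := by
  funext i
  have h1 : (i : ℕ) < P.length + P.length * P.length := by have := i.is_lt; omega
  simp [labOf, answerBits, answers, queryAnswer, List.getD_eq_getElem?_getD, List.getElem?_range h1]

theorem cmpOf_answerBits (h : Halfspace) (P : List Plane) :
    cmpOf P.length (answerBits h P) = (answers h P.get).2 := by
  funext i j
  have h0 : 0 < P.length := by have := i.is_lt; omega
  have h1 : P.length + (i * P.length + j) < P.length + P.length * P.length := by
    have := i.is_lt
    have := j.is_lt
    nlinarith
  have h2 : ((i : ℕ) * P.length + j) / P.length = i := by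
    rw [mul_comm, Nat.mul_add_div h0, Nat.div_eq_of_lt j.is_lt, add_zero]
  have h3 : ((i : ℕ) * P.length + j) % P.length = j := by
    rw [mul_comm, Nat.mul_add_mod, Nat.mod_eq_of_lt j.is_lt]
  simp [cmpOf, answerBits, answers, queryAnswer, List.getD_eq_getElem?_getD,
    List.getElem?_range h1, h2, h3]

/-! ### The learner -/

/-- The work tape after a sample has been processed. -/
def nextWork (B s l n : ℕ) (bits : List Bool) : List Bool :=
  if s % B = 0 then pack 0 [] else pack (control 1 l n) bits

/-- Query all stored points; then forget a point, halt, or start to sample. -/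
noncomputable def queryAction (N n : ℕ) (bits : List Bool) (s : ℕ) : Action n :=
  if h1 : bits.length < n then .askLabel ⟨bits.length, h1⟩
  else if h2 : bits.length < n + n * n then
    .askCompare ⟨(bits.length - n) / n, Nat.div_lt_of_lt_mul (by omega)⟩
      ⟨(bits.length - n) % n, Nat.mod_lt _ (Nat.pos_of_ne_zero (by rintro rfl; simp at h2))⟩
  else if 10 < n then
    -- Mode 2 is a deletion with `l = 0`. The cap `min i n` bounds the written number at every leaf
    -- and does not affect the index found, which is below `n`.
    .compute ((removalTree n (labOf n bits) (cmpOf n bits)).map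
      (fun i => pack (control 2 n (min i n)) []))
  else if s = N then .output (inferTree n (labOf n bits) (cmpOf n bits))
  else .compute (.leaf (pack (control 1 n n) bits))

/-- Sample a point if `n = k`; test whether it can be inferred if `n = k + 1`. -/
noncomputable def sampleAction (B n : ℕ) (bits : List Bool) (s l k : ℕ) : Action n :=
  if h : l < n ∧ n = k + 1 then
    .compute (((inferTree l (labOf l bits) (cmpOf l bits)).rename
      (fun o : Option (Fin l) => o.elim (⟨n - 1, by omega⟩ : Fin n)
        (fun i => ⟨i, i.is_lt.trans h.1⟩))).map
      -- Here `n` already counts the fresh point: it stays if it cannot be inferred and at most 19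
      -- points then follow the first `l`. Otherwise the last index `n - 1` is marked for deletion.
      (fun o => if o = none ∧ n ≤ l + 19 then nextWork B s l n bits
        else pack (control (l + 2) n (n - 1)) bits))
  else .sample

/-- Discard a point if `n = k`; continue if this has been done. -/
def deleteAction (B n : ℕ) (bits : List Bool) (s l k i : ℕ) : Action n :=
  if h : n = k ∧ i < n then .discard ⟨i, h.2⟩
  else .compute (.leaf (nextWork B s l n bits))

/-- The learner, with `B` samples in a phase and `N` samples in total. -/
noncomputable def halfspaceLearner (B N : ℕ) : Learner := fun n w s _ =>
  if (unpackNum w).unpair.1 = 0 then queryAction N n (unpackBits w) s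
  else if (unpackNum w).unpair.1 = 1 then
    sampleAction B n (unpackBits w) s (unpackNum w).unpair.2.unpair.1
      (unpackNum w).unpair.2.unpair.2
  else deleteAction B n (unpackBits w) s ((unpackNum w).unpair.1 - 2)
    (unpackNum w).unpair.2.unpair.1 (unpackNum w).unpair.2.unpair.2

theorem halfspaceLearner_query {B N n : ℕ} {w : List Bool} {s q : ℕ} (hw : unpackNum w = 0) :
    halfspaceLearner B N n w s q = queryAction N n (unpackBits w) s := by
  simp [halfspaceLearner, hw]

theorem halfspaceLearner_sample (B N n : ℕ) (bits : List Bool) (s q l k : ℕ) :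
    halfspaceLearner B N n (pack (control 1 l k) bits) s q = sampleAction B n bits s l k := by
  simp [halfspaceLearner, unpackNum_pack, unpackBits_pack, control]

theorem halfspaceLearner_delete (B N n : ℕ) (bits : List Bool) (s q l k i : ℕ) :
    halfspaceLearner B N n (pack (control (l + 2) k i) bits) s q =
      deleteAction B n bits s l k i := by
  simp [halfspaceLearner, unpackNum_pack, unpackBits_pack, control]

/-! ### Space and time of single steps -/

/-- A bound for the sizes of the trees. -/
noncomputable def maxTree : ℕ :=
  ∑ n ∈ Finset.range 31, ∑ lab : Fin n → Bool, ∑ cmp : Fin n → Fin n → Bool,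
    ((inferTree n lab cmp).size (fun _ => 0) + (removalTree n lab cmp).size (fun _ => 0))

/-- A bound for the number of bits at a leaf, when the work tape has length at most `W`. -/
def maxLeaf (W : ℕ) : ℕ := ((W + 100 + 1) ^ 2 + 1) ^ 2 + 1 + W

/-- A bound for the sizes of the actions, when the work tape has length at most `W`. -/
noncomputable def maxAction (W : ℕ) : ℕ := (maxTree + 1) * (1 + maxLeaf W)

theorem size_trees_le {n : ℕ} (hn : n ≤ 30) (lab : Fin n → Bool) (cmp : Fin n → Fin n → Bool) :
    (inferTree n lab cmp).size (fun _ => 0) + (removalTree n lab cmp).size (fun _ => 0)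
      ≤ maxTree := by
  have h1 : ∑ lab : Fin n → Bool, ∑ cmp : Fin n → Fin n → Bool,
      ((inferTree n lab cmp).size (fun _ => 0) + (removalTree n lab cmp).size (fun _ => 0))
        ≤ maxTree :=
    Finset.single_le_sum (f := fun n => ∑ lab : Fin n → Bool, ∑ cmp : Fin n → Fin n → Bool,
      ((inferTree n lab cmp).size (fun _ => 0) + (removalTree n lab cmp).size (fun _ => 0)))
      (fun _ _ => Nat.zero_le _) (Finset.mem_range.2 (by omega))
  refine le_trans ?_ h1
  refine le_trans ?_ (Finset.single_le_sum (fun _ _ => Nat.zero_le _) (Finset.mem_univ lab))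
  exact Finset.single_le_sum (f := fun cmp => (inferTree n lab cmp).size (fun _ => 0) +
    (removalTree n lab cmp).size (fun _ => 0)) (fun _ _ => Nat.zero_le _) (Finset.mem_univ cmp)

theorem length_pack_le {W a b c : ℕ} {bits : List Bool} (ha : a ≤ W + 100)
    (hb : b ≤ W + 100) (hc : c ≤ W + 100) (hbits : bits.length ≤ W) :
    (pack (control a b c) bits).length ≤ maxLeaf W := by
  rw [length_pack]
  have := control_lt ha hb hc
  unfold maxLeaf
  omega

theorem length_nextWork_le {W B s l n : ℕ} {bits : List Bool} (hl : l ≤ W + 100)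
    (hn : n ≤ W + 100) (hbits : bits.length ≤ W) :
    (nextWork B s l n bits).length ≤ maxLeaf W := by
  unfold nextWork
  split_ifs
  · rw [length_pack, List.length_nil]
    unfold maxLeaf
    exact (Nat.le_add_left 1 _).trans (Nat.le_add_right _ _)
  · exact length_pack_le (by omega) hl hn hbits

/-- The bound holds for every short tape, reachable or not: decoded numbers are at most the tape
length, and there are only finitely many trees on at most 30 points. -/
theorem size_action_le {W B N n : ℕ} {w : List Bool} {s q : ℕ} (hn : n ≤ 30)
    (hw : w.length ≤ W) : (halfspaceLearner B N n w s q).size ≤ maxAction W := by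
  have hbits := (length_unpackBits_le w).trans hw
  have hnum := (unpackNum_le w).trans hw
  have ha := Nat.unpair_left_le (unpackNum w)
  have hb := (Nat.unpair_left_le _).trans (Nat.unpair_right_le (unpackNum w))
  have hc := (Nat.unpair_right_le _).trans (Nat.unpair_right_le (unpackNum w))
  have hleaf : 1 + maxLeaf W ≤ maxAction W := by
    unfold maxAction
    nlinarith [Nat.zero_le (maxTree * (1 + maxLeaf W))]
  have htree : maxTree ≤ maxAction W := by
    unfold maxAction
    nlinarith [Nat.zero_le (maxTree * maxLeaf W), Nat.zero_le (maxLeaf W)]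
  have hmap : ∀ {ι α : Type} (t : DecisionTree ι α) (g : α → List Bool),
      t.size (fun _ => 0) ≤ maxTree → (∀ a, (g a).length ≤ maxLeaf W) →
      (t.map g).size List.length ≤ maxAction W := by
    intro ι α t g ht hg
    refine (t.size_map_le g List.length hg).trans ?_
    unfold maxAction
    gcongr
    omega
  unfold halfspaceLearner
  generalize unpackBits w = bits at hbits ⊢
  split_ifs
  · unfold queryAction
    split_ifs
    · exact Nat.zero_le _
    · exact Nat.zero_le _
    · refine hmap _ _ ?_ fun i => length_pack_le (by omega) (by omega) (by omega) (Nat.zero_le _)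
      have := size_trees_le hn (labOf n bits) (cmpOf n bits)
      omega
    · refine le_trans ?_ htree
      have := size_trees_le hn (labOf n bits) (cmpOf n bits)
      simp only [Action.size]
      omega
    · refine le_trans ?_ hleaf
      simp only [Action.size, DecisionTree.size]
      have := length_pack_le (a := 1) (b := n) (c := n) (by omega) (by omega) (by omega) hbits
      omega
  · unfold sampleAction
    split_ifs with h
    · refine hmap _ _ ?_ fun o => ?_
      · rw [DecisionTree.size_rename]
        have := size_trees_le (n := (unpackNum w).unpair.2.unpair.1) (by omega)
          (labOf _ bits) (cmpOf _ bits)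
        omega
      · split_ifs
        · exact length_nextWork_le (by omega) (by omega) hbits
        · exact length_pack_le (by omega) (by omega) (by omega) hbits
    · exact Nat.zero_le _
  · unfold deleteAction
    split_ifs
    · exact Nat.zero_le _
    · refine le_trans ?_ hleaf
      simp only [Action.size, DecisionTree.size]
      have := length_nextWork_le (B := B) (s := s)
        (l := (unpackNum w).unpair.1 - 2) (n := n) (by omega) (by omega) hbits
      omega


/-! ### Runs of the learner -/

/-- A configuration that occupies little memory. -/
def Config.Small (W : ℕ) (c : Config) : Prop := c.points.length ≤ 30 ∧ c.work.length ≤ W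

/-- `c'` is reached from `c` in `k` steps through small configurations. -/
def Path (W : ℕ) (f : Config → Config) : ℕ → Config → Config → Prop
  | 0, c, c' => c = c'
  | k + 1, c, c' => c.Small W ∧ Path W f k (f c) c'

theorem Path.trans {W : ℕ} {f : Config → Config} {k l : ℕ} {a b c : Config} (h1 : Path W f k a b)
    (h2 : Path W f l b c) : Path W f (k + l) a c := by
  induction k generalizing a with
  | zero => rw [Path] at h1; subst h1; simpa using h2
  | succ k ih =>
    rw [show k + 1 + l = (k + l) + 1 by omega]
    exact ⟨h1.1, ih h1.2⟩

/-- `c'` is reached from `c` in at most `K` steps through small configurations. -/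
def Within (W : ℕ) (f : Config → Config) (K : ℕ) (c c' : Config) : Prop :=
  ∃ k ≤ K, Path W f k c c'

theorem Within.refl {W : ℕ} {f : Config → Config} {K : ℕ} (c : Config) : Within W f K c c :=
  ⟨0, Nat.zero_le _, rfl⟩

theorem Within.trans {W : ℕ} {f : Config → Config} {k l K : ℕ} {a b c : Config}
    (h1 : Within W f k a b) (h2 : Within W f l b c) (hK : k + l ≤ K) : Within W f K a c := by
  obtain ⟨i, hi, h1⟩ := h1
  obtain ⟨j, hj, h2⟩ := h2
  exact ⟨i + j, by omega, h1.trans h2⟩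

theorem Within.step {W : ℕ} {f : Config → Config} {c c' : Config} (hc : c.Small W)
    (h : f c = c') : Within W f 1 c c' :=
  ⟨1, le_rfl, hc, h⟩

/-! ### Effects of single actions, halting, and paths. -/

namespace Learner

variable {A : Learner} {h : Halfspace} {ω : ℕ → Plane} {c : Config}

theorem step_sample (ha : A.action c = .sample) : A.step h ω c =
    { c with points := c.points ++ [ω c.samples], samples := c.samples + 1 } := by
  simp only [step, ha]

theorem step_discard {i : Fin c.points.length} (ha : A.action c = .discard i) :
    A.step h ω c = { c with points := c.points.eraseIdx i } := by
  simp only [step, ha]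

theorem step_askLabel {i : Fin c.points.length} (ha : A.action c = .askLabel i) :
    A.step h ω c =
      { c with work := c.work ++ [h.label (c.points.get i)], queries := c.queries + 1 } := by
  simp only [step, ha]

theorem step_askCompare {i j : Fin c.points.length} (ha : A.action c = .askCompare i j) :
    A.step h ω c =
      { c with
        work := c.work ++ [h.compare (c.points.get i) (c.points.get j)]
        queries := c.queries + 1 } := by
  simp only [step, ha]

theorem step_compute {t : DecisionTree (Fin c.points.length) (List Bool)}
    (ha : A.action c = .compute t) : A.step h ω c = { c with work := t.eval c.points.get } := by
  simp only [step, ha]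

theorem step_halts (ha : (A.action c).Halts) : A.step h ω c = c := by
  unfold step
  split <;> simp_all [Action.Halts]

theorem config_of_haltsAt {n k : ℕ} (hn : A.HaltsAt h ω n) :
    A.config h ω (n + k) = A.config h ω n := by
  induction k with
  | zero => rfl
  | succ k ih =>
    rw [show n + (k + 1) = (n + k) + 1 by omega, config, ih]
    exact step_halts hn

/-- Halting configurations are fixed points, so any halting time gives the same classifier as the
first one. -/
theorem answer_of_haltsAt {n : ℕ} (hn : A.HaltsAt h ω n) (x : Plane) :
    A.answer h ω x = (A.action (A.config h ω n)).classify (A.config h ω n).points.get x := by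
  classical
  have H : ∃ n, A.HaltsAt h ω n := ⟨n, hn⟩
  have e : A.config h ω n = A.config h ω (Nat.find H) := by
    obtain ⟨k, hk⟩ := Nat.exists_eq_add_of_le (Nat.find_min' H hn)
    rw [hk]
    exact config_of_haltsAt (Nat.find_spec H)
  rw [answer, dif_pos H, e]

theorem config_of_path {W k n : ℕ} {c' : Config} (hp : Path W (A.step h ω) k (A.config h ω n) c') :
    A.config h ω (n + k) = c' ∧ ∀ i < k, (A.config h ω (n + i)).Small W := by
  induction k generalizing n with
  | zero => exact ⟨hp, fun i hi => absurd hi (Nat.not_lt_zero i)⟩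
  | succ k ih =>
    obtain ⟨h1, h2⟩ := ih (n := n + 1) hp.2
    refine ⟨by rw [← h1]; congr 1; omega, fun i hi => ?_⟩
    cases i with
    | zero => exact hp.1
    | succ i =>
      have := h2 i (by omega)
      rwa [show n + 1 + i = n + (i + 1) by omega] at this

end Learner

section Simulation

variable {W B N : ℕ} (h : Halfspace) (ω : ℕ → Plane)

theorem length_answerBits (P : List Plane) :
    (answerBits h P).length = P.length + P.length * P.length := by
  simp [answerBits]

/-- Control numbers are written in unary. With parameters at most 40 they stay below `(41 ^ 2 + 1) ^
2 = 2829124`, which leaves room for 1000 recorded bits. -/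
theorem small_control (hW : 3000000 ≤ W) {P : List Plane} {a b c : ℕ} {bits : List Bool} {s q : ℕ}
    (hP : P.length ≤ 30) (ha : a ≤ 40) (hb : b ≤ 40) (hc : c ≤ 40) (hbits : bits.length ≤ 1000) :
    Config.Small W ⟨P, pack (control a b c) bits, s, q⟩ := by
  refine ⟨hP, ?_⟩
  have := control_lt ha hb hc
  simp only [length_pack]
  norm_num at this
  omega

theorem small_query (hW : 3000000 ≤ W) {P : List Plane} {bits : List Bool} {s q : ℕ}
    (hP : P.length ≤ 30) (hbits : bits.length ≤ 1000) :
    Config.Small W ⟨P, pack 0 bits, s, q⟩ := by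
  refine ⟨hP, ?_⟩
  simp only [length_pack]
  omega

theorem length_sq_le {n m : ℕ} (hn : n ≤ m) : n + n * n ≤ m + m * m := by
  have := Nat.mul_le_mul hn hn
  omega

/-- The learner asks all queries. -/
theorem path_queries (hW : 3000000 ≤ W) {P : List Plane} (hP : P.length ≤ 30) (s q i : ℕ)
    (hi : i ≤ P.length + P.length * P.length) :
    Path W ((halfspaceLearner B N).step h ω) i ⟨P, pack 0 [], s, q⟩
      ⟨P, pack 0 ((List.range i).map (queryAnswer h P)), s, q + i⟩ := by
  induction i with
  | zero => simp [Path]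
  | succ i ih =>
    have hlen := length_sq_le hP
    refine (ih (by omega)).trans (l := 1) ⟨small_query hW hP (by simp; omega), ?_⟩
    set c : Config := ⟨P, pack 0 ((List.range i).map (queryAnswer h P)), s, q + i⟩
    have hact : (halfspaceLearner B N).action c =
        queryAction N P.length ((List.range i).map (queryAnswer h P)) s := by
      have := halfspaceLearner_query (B := B) (N := N) (n := P.length) (s := s) (q := q + i)
        (unpackNum_pack 0 ((List.range i).map (queryAnswer h P)))
      rwa [unpackBits_pack] at this
    rw [Path]
    by_cases h1 : i < P.length
    · have ha : (halfspaceLearner B N).action c = .askLabel ⟨i, h1⟩ := by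
        rw [hact, queryAction, dif_pos (by simpa using h1)]
        simp
      rw [Learner.step_askLabel ha]
      change Config.mk P (pack 0 ((List.range i).map (queryAnswer h P)) ++
        [h.label (P.get ⟨i, h1⟩)]) s (q + i + 1) = _
      simp only [pack_append, List.range_succ, List.map_append, List.map_singleton, add_assoc]
      simp [queryAnswer, h1]
    · have h2 : i < P.length + P.length * P.length := by omega
      have hn : 0 < P.length := by
        rcases Nat.eq_zero_or_pos P.length with h0 | h0
        · simp [h0] at h2
        · exact h0
      have h3 : (i - P.length) / P.length < P.length := Nat.div_lt_of_lt_mul (by omega)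
      have h4 : (i - P.length) % P.length < P.length := Nat.mod_lt _ hn
      have ha : (halfspaceLearner B N).action c = .askCompare ⟨_, h3⟩ ⟨_, h4⟩ := by
        rw [hact, queryAction, dif_neg (by simpa using h1), dif_pos (by simpa using h2)]
        simp
      rw [Learner.step_askCompare ha]
      change Config.mk P (pack 0 ((List.range i).map (queryAnswer h P)) ++
        [h.compare (P.get ⟨_, h3⟩) (P.get ⟨_, h4⟩)]) s (q + i + 1) = _
      simp only [pack_append, List.range_succ, List.map_append, List.map_singleton, add_assoc]
      simp [queryAnswer, h1, h3, h4]

theorem action_of_answerBits {P : List Plane} {w : List Bool} (hw0 : unpackNum w = 0)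
    (hwb : unpackBits w = answerBits h P) (s q : ℕ) :
    (halfspaceLearner B N).action ⟨P, w, s, q⟩ =
      if 10 < P.length then
        .compute ((removalTree P.length (answers h P.get).1 (answers h P.get).2).map
          (fun i => pack (control 2 P.length (min i P.length)) []))
      else if s = N then .output (inferTree P.length (answers h P.get).1 (answers h P.get).2)
      else .compute (.leaf (pack (control 1 P.length P.length) (answerBits h P))) := by
  have h1 := halfspaceLearner_query (B := B) (N := N) (n := P.length) (s := s) (q := q) hw0
  rw [hwb] at h1
  refine h1.trans ?_
  have hl := length_answerBits h P
  rw [queryAction, dif_neg (by omega), dif_neg (by omega), labOf_answerBits, cmpOf_answerBits]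

/-- The learner queries and forgets stored points until at most ten remain. -/
theorem within_compress (hW : 3000000 ≤ W) {s : ℕ} (hs : s % B = 0) {P : List Plane}
    (hP : P.length ≤ 30) (q : ℕ) :
    ∃ q' ≤ q + (P.length + 1) * 1000, Within W ((halfspaceLearner B N).step h ω)
      ((P.length + 1) * 1000) ⟨P, pack 0 [], s, q⟩
      ⟨compress h P, pack 0 (answerBits h (compress h P)), s, q'⟩ := by
  induction hn : P.length using Nat.strong_induction_on generalizing P q with
  | _ n ih =>
    subst hn
    have hlen := length_sq_le hP
    have h1 := path_queries (B := B) (N := N) h ω hW hP s q _ le_rfl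
    change Path _ _ _ _ ⟨P, pack 0 (answerBits h P), _, _⟩ at h1
    -- At most 30 points give at most `30 + 30 * 30 = 930` queries, so a round with its three
    -- further steps fits into 1000.
    have hw1 : Within W ((halfspaceLearner B N).step h ω) 930 ⟨P, pack 0 [], s, q⟩
        ⟨P, pack 0 (answerBits h P), s, q + (P.length + P.length * P.length)⟩ :=
      ⟨_, by omega, h1⟩
    by_cases h10 : P.length ≤ 10
    · rw [compress_of_le h10]
      have h110 := length_sq_le h10
      exact ⟨_, by omega, hw1.trans (Within.refl (K := 0) _) (by omega)⟩
    · have hrem := removal_lt (n := P.length) (by omega) P.get (answers h P.get).1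
        (answers h P.get).2
      set q1 := q + (P.length + P.length * P.length) with hq1
      set i := removal P.get (answers h P.get).1 (answers h P.get).2 with hi
      have hf : (forget h P).length = P.length - 1 := length_forget (by omega)
      have hw2 : Within W ((halfspaceLearner B N).step h ω) 1
          ⟨P, pack 0 (answerBits h P), s, q1⟩ ⟨P, pack (control 2 P.length i) [], s, q1⟩ := by
        refine Within.step (small_query hW hP (by rw [length_answerBits]; omega)) ?_
        have ha := action_of_answerBits (B := B) (N := N) h (unpackNum_pack 0 (answerBits h P))
          (unpackBits_pack 0 (answerBits h P)) s q1
        rw [if_pos (by omega)] at ha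
        rw [Learner.step_compute ha, DecisionTree.eval_map, eval_removalTree, ← hi,
          min_eq_left hrem.le]
      have hw3 : Within W ((halfspaceLearner B N).step h ω) 1
          ⟨P, pack (control 2 P.length i) [], s, q1⟩
          ⟨forget h P, pack (control 2 P.length i) [], s, q1⟩ := by
        refine Within.step (small_control hW hP (by omega) (by omega) (by omega) (by simp)) ?_
        have ha : (halfspaceLearner B N).action ⟨P, pack (control 2 P.length i) [], s, q1⟩ =
            .discard ⟨i, hrem⟩ := by
          refine (halfspaceLearner_delete B N P.length [] s q1 0 P.length i).trans ?_
          rw [deleteAction, dif_pos ⟨rfl, hrem⟩]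
        rw [Learner.step_discard ha]
        rfl
      have hw4 : Within W ((halfspaceLearner B N).step h ω) 1
          ⟨forget h P, pack (control 2 P.length i) [], s, q1⟩ ⟨forget h P, pack 0 [], s, q1⟩ := by
        have hf30 : (forget h P).length ≤ 30 := by omega
        refine Within.step (small_control hW hf30 (by omega) (by omega) (by omega) (by simp)) ?_
        have ha : (halfspaceLearner B N).action
            ⟨forget h P, pack (control 2 P.length i) [], s, q1⟩ = .compute (.leaf (pack 0 [])) := by
          -- The length no longer equals the recorded `P.length`, which signals that the deletion is
          -- done. At a phase boundary the tape is then reset for a new round of queries.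
          refine (halfspaceLearner_delete B N (forget h P).length [] s q1 0 P.length i).trans ?_
          rw [deleteAction, dif_neg (fun hc => by have := hc.1; omega), nextWork, if_pos hs]
        rw [Learner.step_compute ha]
        rfl
      obtain ⟨q', hq', hw5⟩ := ih (P.length - 1) (by omega) (P := forget h P) (by omega) q1 hf
      rw [compress_of_lt (by omega)]
      refine ⟨q', by omega, ?_⟩
      exact (((hw1.trans hw2 le_rfl).trans hw3 le_rfl).trans hw4 le_rfl).trans hw5 (by omega)

/-- The learner processes one sample. -/
theorem within_sample (hW : 3000000 ≤ W) {σ y : List Plane} (hσ : σ.length ≤ 10)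
    (hy : y.length ≤ 19) (s q : ℕ) :
    Within W ((halfspaceLearner B N).step h ω) 4
      ⟨σ ++ y, pack (control 1 σ.length (σ.length + y.length)) (answerBits h σ), s, q⟩
      ⟨σ ++ collectOne h σ y (ω s), nextWork B (s + 1) σ.length
        (σ.length + (collectOne h σ y (ω s)).length) (answerBits h σ), s + 1, q⟩ := by
  classical
  set bits := answerBits h σ with hbits
  have hbl : bits.length ≤ 1000 := by
    rw [hbits, length_answerBits]
    have := length_sq_le hσ
    omega
  set l := σ.length with hl
  set k := l + y.length with hk
  have hk' : (σ ++ y).length = k := by simp [hk, hl]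
  set P := σ ++ y ++ [ω s] with hPdef
  have hP : P.length = k + 1 := by simp [hPdef, hk, hl]; omega
  have hw1 : Within W ((halfspaceLearner B N).step h ω) 1
      ⟨σ ++ y, pack (control 1 l k) bits, s, q⟩ ⟨P, pack (control 1 l k) bits, s + 1, q⟩ := by
    refine Within.step (small_control hW (by omega) (by omega) (by omega) (by omega) hbl) ?_
    have ha : (halfspaceLearner B N).action ⟨σ ++ y, pack (control 1 l k) bits, s, q⟩ =
        .sample := by
      refine (halfspaceLearner_sample B N (σ ++ y).length bits s q l k).trans ?_
      rw [sampleAction, dif_neg (fun hc => by have := hc.2; omega)]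
    rw [Learner.step_sample ha]
  have htest : (halfspaceLearner B N).step h ω ⟨P, pack (control 1 l k) bits, s + 1, q⟩ =
      ⟨P, if ω s ∈ unknown h σ ∧ k + 1 ≤ l + 19 then nextWork B (s + 1) l (k + 1) bits
        else pack (control (l + 2) (k + 1) k) bits, s + 1, q⟩ := by
    -- One point more than the recorded number `k` signals that the fresh sample awaits its test.
    have hcond : l < P.length ∧ P.length = k + 1 := by omega
    have ha := halfspaceLearner_sample B N P.length bits (s + 1) q l k
    rw [sampleAction, dif_pos hcond] at ha
    have ha' : (halfspaceLearner B N).action ⟨P, pack (control 1 l k) bits, s + 1, q⟩ = _ := ha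
    rw [Learner.step_compute ha', DecisionTree.eval_map, DecisionTree.eval_rename, eval_inferTree]
    have e1 : labOf l bits = (answers h σ.get).1 := labOf_answerBits h σ
    have e2 : cmpOf l bits = (answers h σ.get).2 := cmpOf_answerBits h σ
    have e3 : (fun i : Fin l => P.get ((some i).elim (⟨P.length - 1, by omega⟩ : Fin P.length)
        (fun i : Fin l => ⟨i, i.is_lt.trans hcond.1⟩))) = σ.get := by
      funext i
      simp only [hPdef, Option.elim_some, List.get_eq_getElem, List.append_assoc]
      exact List.getElem_append_left i.is_lt
    have e4 : P.get ((none : Option (Fin l)).elim (⟨P.length - 1, by omega⟩ : Fin P.length)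
        (fun i : Fin l => ⟨i, i.is_lt.trans hcond.1⟩)) = ω s := by
      simp [hPdef]
    rw [e1, e2]
    have e5 := infer_get_eq_none (h := h) (l := σ) (x := ω s)
    simp only [e3, e4]
    simp only [answers, e5, hP, Nat.add_sub_cancel]
  have hPs : Config.Small W ⟨P, pack (control 1 l k) bits, s + 1, q⟩ :=
    small_control hW (by omega) (by omega) (by omega) (by omega) hbl
  by_cases hkeep : ω s ∈ unknown h σ ∧ k + 1 ≤ l + 19
  · have hc : collectOne h σ y (ω s) = y ++ [ω s] := by
      rw [collectOne, if_pos ⟨hkeep.1, by omega⟩]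
    rw [if_pos hkeep] at htest
    refine hw1.trans (Within.step hPs (htest.trans ?_)) (by omega)
    rw [hc, ← List.append_assoc, ← hPdef]
    congr 2
    simp [hk, add_assoc]
  · have hc : collectOne h σ y (ω s) = y := by
      rw [collectOne, if_neg (fun hcon => hkeep ⟨hcon.1, by omega⟩)]
    rw [if_neg hkeep] at htest
    have hw2 := Within.step hPs htest
    have hw3 : Within W ((halfspaceLearner B N).step h ω) 1
        ⟨P, pack (control (l + 2) (k + 1) k) bits, s + 1, q⟩
        ⟨σ ++ y, pack (control (l + 2) (k + 1) k) bits, s + 1, q⟩ := by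
      refine Within.step (small_control hW (by omega) (by omega) (by omega) (by omega) hbl) ?_
      have ha : (halfspaceLearner B N).action
          ⟨P, pack (control (l + 2) (k + 1) k) bits, s + 1, q⟩ =
          .discard (⟨k, by omega⟩ : Fin P.length) := by
        refine (halfspaceLearner_delete B N P.length bits (s + 1) q l (k + 1) k).trans ?_
        rw [deleteAction, dif_pos ⟨hP, by omega⟩]
      rw [Learner.step_discard ha]
      have : P.eraseIdx k = σ ++ y := by
        rw [hPdef, List.eraseIdx_append_of_length_le (by omega), hk']
        simp
      simp only [this]
    have hw4 : Within W ((halfspaceLearner B N).step h ω) 1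
        ⟨σ ++ y, pack (control (l + 2) (k + 1) k) bits, s + 1, q⟩
        ⟨σ ++ y, nextWork B (s + 1) l k bits, s + 1, q⟩ := by
      refine Within.step (small_control hW (by omega) (by omega) (by omega) (by omega) hbl) ?_
      have ha : (halfspaceLearner B N).action
          ⟨σ ++ y, pack (control (l + 2) (k + 1) k) bits, s + 1, q⟩ =
          .compute (.leaf (nextWork B (s + 1) l k bits)) := by
        refine (halfspaceLearner_delete B N (σ ++ y).length bits (s + 1) q l (k + 1) k).trans ?_
        rw [deleteAction, dif_neg (fun hcon => by have := hcon.1; omega), hk']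
      rw [Learner.step_compute ha]
      rfl
    rw [hc]
    exact ((hw1.trans hw2 le_rfl).trans hw3 le_rfl).trans hw4 le_rfl

/-- The learner processes the remaining samples of a phase. -/
theorem within_collect (hW : 3000000 ≤ W) {σ : List Plane} (hσ : σ.length ≤ 10) (q k : ℕ)
    {y : List Plane} (hy : y.length ≤ 19) {s : ℕ} (hs : (s + k) % B = 0) (hk0 : 0 < k)
    (hk : k ≤ B) :
    Within W ((halfspaceLearner B N).step h ω) (4 * k)
      ⟨σ ++ y, pack (control 1 σ.length (σ.length + y.length)) (answerBits h σ), s, q⟩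
      ⟨σ ++ collect h σ k y (fun i => ω (s + i)), pack 0 [], s + k, q⟩ := by
  induction k generalizing y s with
  | zero => omega
  | succ k ih =>
    have h1 := within_sample (B := B) (N := N) h ω hW hσ hy s q
    rcases Nat.eq_zero_or_pos k with rfl | hk1
    · rw [nextWork, if_pos hs] at h1
      exact h1
    -- Otherwise `B` would divide the number `k` of samples still to come, although `0 < k < B`; the
    -- phase cannot end early.
    · have h2 : (s + 1) % B ≠ 0 := by
        intro hc
        have h3 : B ∣ k := by
          have := (Nat.dvd_sub (Nat.dvd_of_mod_eq_zero hs) (Nat.dvd_of_mod_eq_zero hc))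
          rwa [show s + (k + 1) - (s + 1) = k by omega] at this
        have := Nat.le_of_dvd hk1 h3
        omega
      rw [nextWork, if_neg h2] at h1
      have h3 := ih (length_collectOne (h := h) (σ := σ) (z := ω s) hy) (s := s + 1)
        (by rw [← hs]; congr 1; omega) hk1 (by omega)
      have h4 := h1.trans h3 (K := 4 * (k + 1)) (by omega)
      rw [show s + 1 + k = s + (k + 1) by omega] at h4
      have h5 : (fun i => ω (s + 1 + i)) = fun i => ω (s + (i + 1)) := by
        funext i
        congr 1
        omega
      rw [h5] at h4
      exact h4

theorem length_collect {h : Halfspace} {σ : List Plane} (k : ℕ) {y : List Plane}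
    (hy : y.length ≤ 19) (ω : ℕ → Plane) : (collect h σ k y ω).length ≤ 19 := by
  induction k generalizing y ω with
  | zero => exact hy
  | succ k ih => exact ih (length_collectOne hy) _

/-- The learner runs all phases. -/
theorem within_phases (hW : 3000000 ≤ W) (hB : 0 < B) (t : ℕ) {σ : List Plane}
    (hσ : σ.length ≤ 10) {w : List Bool} (hw : w.length ≤ W) (hw0 : unpackNum w = 0)
    (hwb : unpackBits w = answerBits h σ) {s : ℕ} (hs : s % B = 0) (hN : s + t * B = N) (q : ℕ) :
    ∃ w' q', q' ≤ q + t * 31000 ∧ w'.length ≤ W ∧ unpackNum w' = 0 ∧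
      unpackBits w' = answerBits h (phases h B t σ (fun i => ω (s + i))) ∧
      Within W ((halfspaceLearner B N).step h ω) (t * (4 * B + 31001)) ⟨σ, w, s, q⟩
        ⟨phases h B t σ (fun i => ω (s + i)), w', N, q'⟩ := by
  induction t generalizing σ w s q with
  | zero =>
    have : s = N := by simpa using hN
    subst this
    exact ⟨w, q, by omega, hw, hw0, hwb, Within.refl _⟩
  | succ t ih =>
    rw [Nat.succ_mul] at hN
    have hw1 : Within W ((halfspaceLearner B N).step h ω) 1 ⟨σ, w, s, q⟩
        ⟨σ, pack (control 1 σ.length σ.length) (answerBits h σ), s, q⟩ := by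
      refine Within.step ⟨by simpa using hσ.trans (by norm_num), hw⟩ ?_
      have ha := action_of_answerBits (B := B) (N := N) h hw0 hwb s q
      rw [if_neg (by omega), if_neg (by omega)] at ha
      rw [Learner.step_compute ha]
      rfl
    have hs' : (s + B) % B = 0 := by rw [Nat.add_mod_right, hs]
    have hw2 := within_collect (B := B) (N := N) h ω hW hσ q B (y := []) (by simp) hs' hB le_rfl
    simp only [List.append_nil, List.length_nil, add_zero] at hw2
    set P := σ ++ collect h σ B [] (fun i => ω (s + i)) with hP
    have hP30 : P.length ≤ 29 := by
      have := length_collect (h := h) (σ := σ) B (y := []) (by simp) (fun i => ω (s + i))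
      rw [hP, List.length_append]
      omega
    obtain ⟨q1, hq1, hw3⟩ := within_compress (B := B) (N := N) h ω hW hs' (P := P) (by omega) q
    have hcl := length_compress h P
    obtain ⟨w', q', hq', h1, h2, h3, hw4⟩ := ih hcl
      (small_query hW (s := 0) (q := 0) (hcl.trans (by norm_num))
        (by rw [length_answerBits]; have := length_sq_le hcl; omega)).2
      (unpackNum_pack 0 _) (unpackBits_pack 0 _) hs' (by omega) q1
    have hshift : (fun i => ω (s + B + i)) = fun i => ω (s + (B + i)) := by
      funext i
      rw [add_assoc]
    rw [hshift] at h3 hw4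
    refine ⟨w', q', ?_, h1, h2, h3, ?_⟩
    · have : (P.length + 1) * 1000 ≤ 31000 := by omega
      rw [Nat.succ_mul t]
      omega
    · refine ((hw1.trans hw2 le_rfl).trans hw3 le_rfl).trans hw4 ?_
      have : (P.length + 1) * 1000 ≤ 31000 := by omega
      rw [Nat.succ_mul t]
      omega

/-- The whole run of the learner. -/
theorem exists_halt (hW : 3000000 ≤ W) (hB : 0 < B) (K : ℕ) :
    ∃ n w q, n ≤ K * (4 * B + 31001) ∧ q ≤ K * 31000 ∧
      (halfspaceLearner B (K * B)).config h ω n = ⟨phases h B K [] ω, w, K * B, q⟩ ∧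
      (∀ i ≤ n, ((halfspaceLearner B (K * B)).config h ω i).Small W) ∧
      (halfspaceLearner B (K * B)).action ⟨phases h B K [] ω, w, K * B, q⟩ =
        .output (inferTree _ (answers h (phases h B K [] ω).get).1
          (answers h (phases h B K [] ω).get).2) := by
  -- The blank initial tape decodes to the number zero and no bits, just as `pack 0 []` does, and no
  -- answers are needed for the empty list of points.
  obtain ⟨w, q, hq, hw, hw0, hwb, n, hn, hp⟩ := within_phases (B := B) (N := K * B) h ω hW hB K
    (σ := []) (by simp) (w := []) (by simp) rfl rfl (s := 0) (by simp) (by simp) 0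
  simp only [zero_add] at hq hwb hp
  replace hwb : unpackBits w = answerBits h (phases h B K [] ω) := hwb
  obtain ⟨h1, h2⟩ := Learner.config_of_path (n := 0) hp
  simp only [zero_add] at h1 h2
  have hlen : (phases h B K [] ω).length ≤ 10 := by
    cases K with
    | zero => simp [phases]
    | succ K =>
      have : ∀ t (σ : List Plane) (ω : ℕ → Plane), σ.length ≤ 10 →
          (phases h B t σ ω).length ≤ 10 := by
        intro t
        induction t with
        | zero => exact fun σ ω hσ => hσ
        | succ t ih => exact fun σ ω _ => ih _ _ (length_compress h _)
      exact this _ _ _ (by simp)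
  refine ⟨n, w, q, hn, hq, h1, fun i hi => ?_, ?_⟩
  · rcases hi.lt_or_eq with hlt | rfl
    · exact h2 i hlt
    · rw [h1]; exact ⟨by simpa using hlen.trans (by norm_num), hw⟩
  · rw [action_of_answerBits h hw0 hwb, if_neg (by omega), if_pos rfl]

end Simulation


/-! ### The main theorem -/

theorem answer_halfspaceLearner {B : ℕ} (hB : 0 < B) (K : ℕ) (h : Halfspace) (ω : ℕ → Plane)
    (x : Plane) : (halfspaceLearner B (K * B)).answer h ω x =
      infer (phases h B K [] ω).get (answers h (phases h B K [] ω).get).1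
        (answers h (phases h B K [] ω).get).2 x := by
  obtain ⟨n, w, q, -, -, hc, -, ha⟩ := exists_halt h ω le_rfl hB K
  have hn : (halfspaceLearner B (K * B)).HaltsAt h ω n := by
    rw [Learner.HaltsAt, hc, ha]
    trivial
  rw [Learner.answer_of_haltsAt hn, hc, ha]
  simp only [Action.classify]
  rw [eval_inferTree]
  rfl

theorem reliable_halfspaceLearner {B : ℕ} (hB : 0 < B) (K : ℕ) :
    (halfspaceLearner B (K * B)).Reliable := by
  intro h ω x hx
  rw [answer_halfspaceLearner hB] at hx ⊢
  obtain ⟨r, hr⟩ := Option.ne_none_iff_exists'.1 hx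
  rw [hr, infer_eq_some hr]

theorem probablyUseful_halfspaceLearner {ε δ : ℝ} (hε : 0 < ε) (hδ : 0 < δ) {B K : ℕ}
    (hB0 : 0 < B) (hB : 32 / ε ≤ B) (hK : (3 / 4 : ℝ) ^ (K + 1) < ε * δ) :
    (halfspaceLearner B ((K + 1) * B)).ProbablyUseful ε δ := by
  intro D _ h
  have e : ∀ ω, {x | (halfspaceLearner B ((K + 1) * B)).answer h ω x = none} =
      unknown h (phases h B (K + 1) [] ω) := by
    intro ω
    ext x
    rw [Set.mem_ofPred_eq, answer_halfspaceLearner hB0]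
    exact infer_get_eq_none
  simp only [e]
  exact measure_phases_lt D h hε hδ hB hK

theorem runsWithin_halfspaceLearner {B : ℕ} (hB : 0 < B) (K : ℕ) {W : ℕ} (hW : 3000000 ≤ W)
    {Q T : ℝ} (hQ : (K : ℝ) * 31000 ≤ Q)
    (hT : ((K : ℝ) * (4 * B + 31001) + 1) * (1 + W + maxAction W : ℕ) ≤ T) :
    (halfspaceLearner B (K * B)).RunsWithin Q T (30 + W + maxAction W) := by
  intro h ω
  obtain ⟨n, w, q, hn, hq, hc, hs, ha⟩ := exists_halt h ω hW hB K
  refine ⟨n, ?_, ?_, ?_, fun i hi => ?_⟩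
  · rw [Learner.HaltsAt, hc, ha]
    trivial
  · rw [hc]
    refine le_trans ?_ hQ
    exact_mod_cast hq
  · refine le_trans ?_ hT
    have h1 : ∑ i ∈ Finset.range (n + 1), (halfspaceLearner B (K * B)).stepTime
        ((halfspaceLearner B (K * B)).config h ω i) ≤ (n + 1) * (1 + W + maxAction W) := by
      refine (Finset.sum_le_card_nsmul _ _ (1 + W + maxAction W) fun i hi => ?_).trans ?_
      · have hi' := hs i (by have := Finset.mem_range.1 hi; omega)
        have := size_action_le (B := B) (N := K * B)
          (s := ((halfspaceLearner B (K * B)).config h ω i).samples)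
          (q := ((halfspaceLearner B (K * B)).config h ω i).queries) hi'.1 hi'.2
        have h2 := hi'.2
        unfold Learner.stepTime Learner.action
        omega
      · rw [Finset.card_range, smul_eq_mul]
    have h2 : (n + 1) * (1 + W + maxAction W) ≤
        (K * (4 * B + 31001) + 1) * (1 + W + maxAction W) :=
      Nat.mul_le_mul (by omega) le_rfl
    exact_mod_cast h1.trans h2
  · have hi' := hs i hi
    have := size_action_le (B := B) (N := K * B)
      (s := ((halfspaceLearner B (K * B)).config h ω i).samples)
      (q := ((halfspaceLearner B (K * B)).config h ω i).queries) hi'.1 hi'.2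
    have h2 := hi'.1
    have h3 := hi'.2
    unfold Learner.space Learner.action
    omega

theorem exists_learner {W : ℕ} (hW : 3000000 ≤ W) {ε δ : ℝ} (hε : 0 < ε) (hε1 : ε < 1)
    (hδ : 0 < δ) {C L : ℝ} (hL : L = max 1 (Real.log (1 / (ε * δ))))
    (hC : C = 200000 * (1 + W + maxAction W : ℕ)) :
    ∃ A : Learner, A.Reliable ∧ A.ProbablyUseful ε δ ∧
      A.RunsWithin (C * L) (C * (L ^ 2 / ε)) (30 + W + maxAction W) := by
  set B := ⌈32 / ε⌉₊ with hB
  -- Since `3 / 4 ≤ exp (-1 / 4)`, more than `4 * L` phases bring the expected excess below `exp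
  -- (-L) ≤ ε * δ`.
  set K := ⌊4 * L⌋₊ with hK
  have hL1 : 1 ≤ L := hL ▸ le_max_left _ _
  have hB1 : 32 / ε ≤ B := Nat.le_ceil _
  have hB2 : (B : ℝ) ≤ 33 / ε := by
    have h1 : (B : ℝ) < 32 / ε + 1 := Nat.ceil_lt_add_one (by positivity)
    have h2 : 1 ≤ 1 / ε := by rw [le_div_iff₀ hε]; linarith
    have h3 : 33 / ε = 32 / ε + 1 / ε := by ring
    linarith
  have hB0 : 0 < B := Nat.ceil_pos.2 (by positivity)
  have hK1 : 4 * L < K + 1 := Nat.lt_floor_add_one _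
  have hK2 : (K : ℝ) ≤ 4 * L := Nat.floor_le (by linarith)
  have hK3 : (3 / 4 : ℝ) ^ (K + 1) < ε * δ := by
    have h1 : (3 / 4 : ℝ) ≤ Real.exp (-(1 / 4)) := by
      have := Real.add_one_le_exp (-(1 / 4 : ℝ))
      linarith
    calc (3 / 4 : ℝ) ^ (K + 1) ≤ Real.exp (-(1 / 4)) ^ (K + 1) :=
          pow_le_pow_left₀ (by norm_num) h1 _
      _ = Real.exp ((K + 1 : ℕ) * -(1 / 4)) := by rw [← Real.exp_nat_mul]
      _ < Real.exp (-L) := by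
          apply Real.exp_lt_exp.2
          push_cast
          linarith
      _ ≤ Real.exp (-Real.log (1 / (ε * δ))) := by
          apply Real.exp_le_exp.2
          have : Real.log (1 / (ε * δ)) ≤ L := hL ▸ le_max_right _ _
          linarith
      _ = ε * δ := by
          rw [one_div, Real.log_inv, neg_neg, Real.exp_log (by positivity)]
  obtain ⟨Z, hZ⟩ : ∃ Z : ℕ, Z = 1 + W + maxAction W := ⟨_, rfl⟩
  rw [← hZ] at hC
  have hZ1 : (1 : ℝ) ≤ Z := by
    have : 1 ≤ Z := by omega
    exact_mod_cast this
  have hK5 : ((K + 1 : ℕ) : ℝ) ≤ 5 * L := by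
    push_cast
    linarith
  refine ⟨halfspaceLearner B ((K + 1) * B), reliable_halfspaceLearner hB0 _,
    probablyUseful_halfspaceLearner hε hδ hB0 hB1 hK3, runsWithin_halfspaceLearner hB0 _ hW ?_ ?_⟩
  · have h1 : L ≤ Z * L := le_mul_of_one_le_left (by linarith) hZ1
    calc _ ≤ (5 * L) * 31000 := by gcongr
      _ ≤ 200000 * (Z * L) := by linarith
      _ = C * L := by rw [hC]; ring
  · rw [hC, ← hZ]
    clear hZ
    have h1 : 1 ≤ 1 / ε := by rw [le_div_iff₀ hε]; linarith
    have h2 : (4 * B + 31001 : ℝ) ≤ 31133 * (1 / ε) := by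
      have : 33 / ε = 33 * (1 / ε) := by ring
      linarith
    have h3 : ((K + 1 : ℕ) : ℝ) * (4 * B + 31001) ≤ 5 * L * (31133 * (1 / ε)) := by
      gcongr
    -- The run costs only a multiple of `L / ε`; this is relaxed to the stated `L ^ 2 / ε`.
    have h4 : L * (1 / ε) ≤ L ^ 2 * (1 / ε) := by
      have : L ≤ L ^ 2 := by nlinarith
      gcongr
    have h5 : 1 ≤ L ^ 2 * (1 / ε) := by nlinarith
    have h6 : ((K + 1 : ℕ) : ℝ) * (4 * B + 31001) + 1 ≤ 200000 * (L ^ 2 * (1 / ε)) := by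
      nlinarith
    calc _ ≤ 200000 * (L ^ 2 * (1 / ε)) * Z := by gcongr
      _ = _ := by ring

end HalfspaceLearning

theorem mainTheorem10 :
    ∃ (C : ℝ) (M : ℕ), ∀ (ε δ : ℝ), 0 < ε → ε < 1 → 0 < δ → δ < 1 →
      ∃ A : HalfspaceLearning.Learner,
        A.Reliable ∧
        A.ProbablyUseful ε δ ∧
        A.RunsWithin
          (C * max 1 (Real.log (1 / (ε * δ))))
          (C * ((max 1 (Real.log (1 / (δ * ε)))) ^ 2 / ε))
          M := by
  -- The tape bound is kept as an opaque variable so that the huge constants built from it are never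
  -- evaluated.
  obtain ⟨W, hW⟩ : ∃ W : ℕ, 3000000 ≤ W := ⟨_, le_rfl⟩
  refine ⟨200000 * (1 + W + HalfspaceLearning.maxAction W : ℕ),
    30 + W + HalfspaceLearning.maxAction W, fun ε δ hε hε1 hδ _ => ?_⟩
  rw [mul_comm δ ε]
  exact HalfspaceLearning.exists_learner hW hε hε1 hδ rfl rfl
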